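/- **Setting.** For each $n$ let $\mathcal L_n$ be a probability law of $(X,Y,Z)\in\mathbb R\times\mathbb R\times\mathbb R^{p_n}$ and let $(\mathbf X,\mathbf Y,\mathbf Z)=\{(X_i,Y_i,Z_i)\}_{i=1}^n$ be i.i.d. from $\mathcal L_n$. Let $\widehat{\mathcal L}_n(\cdot\mid z)$ be a (measurable) estimate of the conditional law of $X$ given $Z=z$ learned from $(\mathbf X,\mathbf Z)$, with mean $\widehat\mu_{n,x}(z)$ and variance $\mathrm{Var}_{\widehat{\mathcal L}_n}[X\mid Z=z]$, and let $\widehat\mu_{n,y}(z)$ be a (measurable) estimate of $\mu_{n,y}(z)=\mathbb E_{\mathcal L_n}[Y\mid Z=z]$ learned from $(\mathbf Y,\mathbf Z)$. Given the data, let $\widetilde X_1,\dots,\widetilde X_n$ be independent with $\widetilde X_i\sim\widehat{\mathcal L}_n(\cdot\mid Z_i)$. For $x\in\mathbb R^n$ put $R_i(x)=(x_i-\widehat\mu_{n,x}(Z_i))(Y_i-\widehat\mu_{n,y}(Z_i))$ and $$T_n(x)=\frac{n^{-1/2}\sum_{i=1}^n R_i(x)}{S_n(x)},\qquad S_n(x)^2=\frac1n\sum_{i=1}^n\Big(R_i(x)-\frac1n\sum_{j=1}^n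 R_j(x)\Big)^2$$ (with $T_n(x)=0$ if $S_n(x)=0$). Thus $T_n(\mathbf X)=T_n^{\mathrm{GCM}}$ is the GCM statistic and $T_n(\widetilde{\mathbf X})$ is the resampled GCM-normalized $\widehat{\mathrm{dCRT}}$ statistic; the learned objects are not refit on resampling. Fix $\alpha\in(0,1)$, let $z_{1-\alpha}$ be the $(1-\alpha)$-quantile of $N(0,1)$, and let $$C_n=\inf\{t:\mathbb P[T_n(\widetilde{\mathbf X})\le t\mid \mathbf X,\mathbf Y,\mathbf Z]\ge 1-\alpha\}$$ be the $(1-\alpha)$-quantile of the conditional law of $T_n(\widetilde{\mathbf X})$ given $(\mathbf X,\mathbf Y,\mathbf Z)$. The normalized $\widehat{\mathrm{dCRT}}$ and GCM tests are $\phi_n^{\mathrm{ndCRT}}=\mathbf 1\{T_n(\mathbf X)>C_n\}$ and $\phi_n^{\mathrm{GCM}}=\mathbf 1\{T_n(\mathbf X)>z_{1-\alpha}\}$. **Theorem.** Assume * (NDG1) for some $\epsilon>0$, $\ \mathbb P_{\mathcal L_n}\big[\frac1n\sum_{i=1}^n \mathrm{Var}_{\widehat{\mathcal L}_n}[X_i\mid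 Z_i]\,(Y_i-\widehat\mu_{n,y}(Z_i))^2\ge\epsilon\big]\to1$; * (NDG2) for all $n$ and $i\le n$, almost surely $0<\mathrm{Var}_{\widehat{\mathcal L}_n}[X_i\mid Z_i],\ (Y_i-\widehat\mu_{n,y}(Z_i))^2,\ (Y_i-\mu_{n,y}(Z_i))^2<\infty$; * (Lyap-1) for some $\delta>0$, in probability, $$\frac1{n^{1+\delta/2}}\sum_{i=1}^n|Y_i-\widehat\mu_{n,y}(Z_i)|^{2+\delta}\,\mathbb E_{\widehat{\mathcal L}_n}\big[|\widetilde X_i-\widehat\mu_{n,x}(Z_i)|^{2+\delta}\mid\mathbf X,\mathbf Z\big]\to0 .$$ Then: 1. $T_n(\widetilde{\mathbf X})$ converges to $N(0,1)$ in distribution conditionally on the data: for every $t\in\mathbb R$, $\ \mathbb P[T_n(\widetilde{\mathbf X})\le t\mid\mathbf X,\mathbf Y,\mathbf Z]\to\Phi(t)$ in probability, where $\Phi$ is the standard normal distribution function; 2. $C_n\to z_{1-\alpha}$ in probability; 3. if moreover the GCM statistic does not accumulate near the limiting critical value, i.e. $\lim_{\delta\downarrow0}\limsup_{n\to\infty}\mathbb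 P_{\mathcal L_n}\big[|T_n^{\mathrm{GCM}}-z_{1-\alpha}|\le\delta\big]=0$, then the two tests are asymptotically equivalent: $\ \lim_{n\to\infty}\mathbb P_{\mathcal L_n}[\phi_n^{\mathrm{ndCRT}}=\phi_n^{\mathrm{GCM}}]=1$. -/

import Mathlib

open MeasureTheory ProbabilityTheory Filter Topology
open scoped ENNReal

noncomputable section

namespace NDCRT

/-! ### Modes of convergence along a sequence of probability spaces -/

/-- Convergence in probability to a constant `c`; the probability space may change with `n`. -/
def TendstoInProb {Ω : ℕ → Type*} [∀ n, MeasurableSpace (Ω n)]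
    (P : ∀ n, Measure (Ω n)) (W : ∀ n, Ω n → ℝ) (c : ℝ) : Prop :=
  ∀ ε : ℝ, 0 < ε → Tendsto (fun n => P n {ω | ε ≤ |W n ω - c|}) atTop (𝓝 0)

/-- `W n` converges in distribution to the law `ν` conditionally on the σ-algebras `F n`:
`P[W n ≤ t | F n] → ν (-∞, t]` in probability at each continuity point `t` of the CDF of `ν`. -/
def CondTendstoInDistribution {Ω : ℕ → Type*}
    (F : ∀ n, MeasurableSpace (Ω n)) [∀ n, MeasurableSpace (Ω n)] (P : ∀ n, Measure (Ω n)) (W : ∀ n, Ω n → ℝ)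
    (ν : Measure ℝ) : Prop :=
  ∀ t : ℝ, ContinuousAt (cdf ν) t →
    TendstoInProb P (fun n => (P n)⟦{ω | W n ω ≤ t} | F n⟧) (cdf ν t)

/-- The `q`-quantile `inf {t : ν (-∞, t] ≥ q}` of a law `ν` on the real line. -/
def quantile (ν : Measure ℝ) (q : ℝ) : ℝ := sInf {t : ℝ | q ≤ ν.real (Set.Iic t)}

/-! ### Data and learned objects -/

/-- The space of the `p`-dimensional covariate vector. -/
abbrev Cov (p : ℕ) : Type := Fin p → ℝ

/-- One observation `(X, Y, Z)`. -/
abbrev Obs (p : ℕ) : Type := ℝ × ℝ × Cov p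

/-- A sample `(X_i, Y_i, Z_i)`, `i = 1, …, n`. -/
abbrev Data (n p : ℕ) : Type := Fin n → Obs p

/-- A procedure that learns the conditional law of `X` given `Z`: from the sample
`(X_i, Z_i)_i` and a point `z` it returns the learned law of `X` given `Z = z`. -/
abbrev LawLearner (n p : ℕ) : Type := Kernel ((Fin n → ℝ × Cov p) × Cov p) ℝ

/-- A procedure that learns the conditional mean of `Y` given `Z`: from the sample
`(Y_i, Z_i)_i` and a point `z` it returns the estimate of the mean of `Y` given `Z = z`. -/
abbrev MeanLearner (n p : ℕ) : Type := (Fin n → ℝ × Cov p) × Cov p → ℝ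

variable {n p : ℕ}

/-- The vector of observed `X_i`. -/
def xObs (d : Data n p) : Fin n → ℝ := fun i => (d i).1

/-- The vector of observed `Y_i`. -/
def yObs (d : Data n p) : Fin n → ℝ := fun i => (d i).2.1

/-- The vector of observed `Z_i`. -/
def zObs (d : Data n p) : Fin n → Cov p := fun i => (d i).2.2

/-- The law of the sample: i.i.d. draws from `L`. -/
def dataLaw (n : ℕ) (L : Measure (Obs p)) : Measure (Data n p) := Measure.pi fun _ => L

/-- The (regular) conditional law of `Y` given `Z` under `L`. -/
def condLawY (L : Measure (Obs p)) [IsFiniteMeasure L] : Kernel (Cov p) ℝ :=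
  condDistrib (fun o : Obs p => o.2.1) (fun o : Obs p => o.2.2) L

/-- The true conditional mean of `Y` given `Z = z` under `L`. -/
def muY (L : Measure (Obs p)) [IsFiniteMeasure L] (z : Cov p) : ℝ := ∫ y, y ∂(condLawY L z)

/-- The learned law of `X_i` given `Z_i`. -/
def fittedLaw (Q : LawLearner n p) (d : Data n p) (i : Fin n) : Measure ℝ :=
  Q (fun j => (xObs d j, zObs d j), zObs d i)

/-- The learned conditional mean of `X` at `Z_i`, i.e. the mean of the learned law. -/
def muHatX (Q : LawLearner n p) (d : Data n p) (i : Fin n) : ℝ := ∫ x, x ∂(fittedLaw Q d i)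

/-- The learned conditional mean of `Y` at `Z_i`. -/
def muHatY (m : MeanLearner n p) (d : Data n p) (i : Fin n) : ℝ :=
  m (fun j => (yObs d j, zObs d j), zObs d i)

/-! ### Resampling -/

lemma measurable_fittedLaw (Q : LawLearner n p) (i : Fin n) :
    Measurable fun d : Data n p => fittedLaw Q d i := by
  unfold fittedLaw xObs zObs
  exact Q.measurable.comp (by fun_prop)

instance (Q : LawLearner n p) [IsMarkovKernel Q] (d : Data n p) (i : Fin n) :
    IsProbabilityMeasure (fittedLaw Q d i) := by
  unfold fittedLaw; infer_instance

lemma measurable_pi_fittedLaw (Q : LawLearner n p) [IsMarkovKernel Q] :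
    Measurable fun d : Data n p => Measure.pi fun i => fittedLaw Q d i := by
  refine Measurable.measure_of_isPiSystem_of_isProbabilityMeasure
    generateFrom_pi.symm isPiSystem_pi ?_
  rintro _ ⟨s, hs, rfl⟩
  simp only [Measure.pi_pi]
  refine Finset.measurable_fun_prod _ fun i _ => ?_
  exact (Measure.measurable_coe (show MeasurableSet (s i) from hs i (Set.mem_univ i))).comp (measurable_fittedLaw Q i)

/-- The conditional law of the resampled vector `X̃` given the data: independent coordinates,
the `i`-th one drawn from the learned law of `X_i` given `Z_i`. -/
def resampleKernel (Q : LawLearner n p) [IsMarkovKernel Q] : Kernel (Data n p) (Fin n → ℝ) where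
  toFun d := Measure.pi fun i => fittedLaw Q d i
  measurable' := measurable_pi_fittedLaw Q

/-- The joint law of the data and of the resampled vector `X̃`. -/
def jointLaw (L : Measure (Obs p)) (Q : LawLearner n p) [IsMarkovKernel Q] :
    Measure (Data n p × (Fin n → ℝ)) :=
  dataLaw n L ⊗ₘ resampleKernel Q

/-- The σ-algebra generated by the data `(X, Y, Z)` on the joint space. -/
abbrev dataSigma (n p : ℕ) : MeasurableSpace (Data n p × (Fin n → ℝ)) :=
  MeasurableSpace.comap Prod.fst inferInstance

/-! ### Test statistics -/

/-- The products of residuals `(x_i - μ̂_x(Z_i)) (Y_i - μ̂_y(Z_i))`. -/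
def residProd (Q : LawLearner n p) (m : MeanLearner n p) (x : Fin n → ℝ) (d : Data n p)
    (i : Fin n) : ℝ :=
  (x i - muHatX Q d i) * (yObs d i - muHatY m d i)

/-- The (unnormalized) statistic, evaluated at a vector `x` in the place of `X`;
the learned objects are not refit. -/
def statDCRT (Q : LawLearner n p) (m : MeanLearner n p) (x : Fin n → ℝ) (d : Data n p) : ℝ :=
  1 / √(n : ℝ) * ∑ i, residProd Q m x d i

/-- The empirical variance of a vector. -/
def empVar (w : Fin n → ℝ) : ℝ :=
  1 / (n : ℝ) * ∑ i, (w i - 1 / (n : ℝ) * ∑ j, w j) ^ 2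

/-- The empirical standard deviation of the products of residuals. -/
def sdGCM (Q : LawLearner n p) (m : MeanLearner n p) (x : Fin n → ℝ) (d : Data n p) : ℝ :=
  √(empVar (residProd Q m x d))

/-- The normalized statistic, evaluated at a vector `x` in the place of `X`; the empirical
standard deviation is recomputed with `x`, the learned objects are not refit. -/
def statNDCRT (Q : LawLearner n p) (m : MeanLearner n p) (x : Fin n → ℝ) (d : Data n p) : ℝ :=
  statDCRT Q m x d / sdGCM Q m x d

/-- The GCM statistic: the normalized statistic evaluated at the observed `X`. -/
def statGCM (Q : LawLearner n p) (m : MeanLearner n p) (d : Data n p) : ℝ :=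
  statNDCRT Q m (xObs d) d

/-- The variance of the resampling distribution of the unnormalized statistic,
`n⁻¹ ∑ Var[X_i | Z_i] (Y_i - μ̂_y(Z_i))²`, the variances being those of the learned law. -/
def resampVar (Q : LawLearner n p) (m : MeanLearner n p) (d : Data n p) : ℝ :=
  1 / (n : ℝ) * ∑ i, variance id (fittedLaw Q d i) * (yObs d i - muHatY m d i) ^ 2

/-- The upper standard normal quantile `z_{1-α}`. -/
def zQuantile (α : ℝ) : ℝ := quantile (gaussianReal 0 1) (1 - α)

/-- The resampling critical value: the `(1-α)`-quantile of the conditional law, given the data,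
of the normalized statistic evaluated at the resampled vector `X̃`. -/
def critNDCRT (Q : LawLearner n p) [IsMarkovKernel Q] (m : MeanLearner n p) (α : ℝ)
    (d : Data n p) : ℝ :=
  quantile ((resampleKernel Q d).map fun x => statNDCRT Q m x d) (1 - α)

/-- The test that compares the normalized statistic with its resampling critical value. -/
def testNDCRT (Q : LawLearner n p) [IsMarkovKernel Q] (m : MeanLearner n p) (α : ℝ) :
    Data n p → ℝ :=
  Set.indicator {d | critNDCRT Q m α d < statNDCRT Q m (xObs d) d} 1

/-- The GCM test, which compares the same statistic with the normal quantile. -/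
def testGCM (Q : LawLearner n p) (m : MeanLearner n p) (α : ℝ) : Data n p → ℝ :=
  Set.indicator {d | zQuantile α < statGCM Q m d} 1

/-! ### Assumptions -/

/-- The quantity in the conditional Lyapunov condition,
`n^{-(1+δ/2)} ∑ |Y_i - μ̂_y(Z_i)|^{2+δ} E[|X̃_i - μ̂_x(Z_i)|^{2+δ} | X, Z]`,
with values in `[0, ∞]`. -/
def lyapunovSum (Q : LawLearner n p) (m : MeanLearner n p) (δ : ℝ) (d : Data n p) : ℝ≥0∞ :=
  ENNReal.ofReal (1 / (n : ℝ) ^ (1 + δ / 2)) *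
    ∑ i, ENNReal.ofReal (|yObs d i - muHatY m d i| ^ (2 + δ)) *
      ∫⁻ x, ENNReal.ofReal (|x - muHatX Q d i| ^ (2 + δ)) ∂(fittedLaw Q d i)

/-- First nondegeneracy condition: with probability tending to one, the variance of the
resampling distribution is bounded below by some positive constant. -/
def Nondegenerate1 (p : ℕ → ℕ) (L : ∀ n, Measure (Obs (p n))) (Q : ∀ n, LawLearner n (p n))
    (m : ∀ n, MeanLearner n (p n)) : Prop :=
  ∃ ε : ℝ, 0 < ε ∧
    Tendsto (fun n => dataLaw n (L n) {d | ε ≤ resampVar (Q n) (m n) d}) atTop (𝓝 1)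

/-- Second nondegeneracy condition: almost surely, the learned variances of `X_i` given `Z_i` are
positive and finite, and the squared residuals of `Y_i` with respect to the learned and to the
true conditional means are positive (and finite: the true conditional mean exists). -/
def Nondegenerate2 (p : ℕ → ℕ) (L : ∀ n, Measure (Obs (p n))) [∀ n, IsFiniteMeasure (L n)]
    (Q : ∀ n, LawLearner n (p n)) (m : ∀ n, MeanLearner n (p n)) : Prop :=
  ∀ n, ∀ᵐ d ∂(dataLaw n (L n)), ∀ i,
    (0 < evariance id (fittedLaw (Q n) d i) ∧ evariance id (fittedLaw (Q n) d i) < ∞) ∧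
    0 < (yObs d i - muHatY (m n) d i) ^ 2 ∧
    (Integrable id (condLawY (L n) (zObs d i)) ∧ 0 < (yObs d i - muY (L n) (zObs d i)) ^ 2)

/-- The conditional Lyapunov condition: for some `δ > 0` the Lyapunov sum converges to zero in
probability. -/
def LyapunovCondition (p : ℕ → ℕ) (L : ∀ n, Measure (Obs (p n))) (Q : ∀ n, LawLearner n (p n))
    (m : ∀ n, MeanLearner n (p n)) : Prop :=
  ∃ δ : ℝ, 0 < δ ∧ ∀ ε : ℝ≥0∞, 0 < ε →
    Tendsto (fun n => dataLaw n (L n) {d | ε ≤ lyapunovSum (Q n) (m n) δ d}) atTop (𝓝 0)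

/-- Non-accumulation of the GCM statistic near the limiting critical value:
`lim_{δ → 0} limsup_n P[|T_n - z_{1-α}| ≤ δ] = 0`. -/
def NonAccumulation (p : ℕ → ℕ) (L : ∀ n, Measure (Obs (p n))) (Q : ∀ n, LawLearner n (p n))
    (m : ∀ n, MeanLearner n (p n)) (α : ℝ) : Prop :=
  Tendsto (fun δ : ℝ => limsup (fun n =>
      dataLaw n (L n) {d | |statGCM (Q n) (m n) d - zQuantile α| ≤ δ}) atTop)
    (𝓝[>] 0) (𝓝 0)

end NDCRT

end

noncomputable section

namespace NDCRT

/-! ### Elementary estimates and Lindeberg's theorem for one row -/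

section OneRow

/-! Once the data are fixed, the resampled residual products are independent and centered, and the
statistic is their studentized sum. The core is therefore a deterministic statement about product
measures, `exists_forall_abs_studentized_sub_cdf_lt`: a lower bound on the average variance and a
small Lyapunov sum force the studentized sum to be nearly normal, uniformly over all arrays. Data
violating either bound have vanishing probability, which gives convergence of the conditional cdf in
probability.

The uniform statement follows by contradiction from a self-normalized Lindeberg theorem along arrays
of counterexamples. After division by the standard deviation of the sum, the statistic is `S / √(Q -
S² / n)`, with `S` the sum and `Q` the sum of squares. Characteristic functions give `S → N(0,1)`,
truncation gives `Q → 1` in `L¹`, and `S² / n` has mean `1 / n`.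

Critical values follow because the normal cdf is strictly below `1 - α` to the left of `z` and
strictly above it to the right. The two tests compare the same statistic with nearby thresholds, so
they can disagree only when the thresholds are far apart or the statistic is near `z`. -/

lemma norm_cexp_sub_taylor_le (x : ℝ) :
    ‖Complex.exp (x * Complex.I) - (1 + x * Complex.I - (x : ℂ) ^ 2 / 2)‖ ≤ 4 * |x| ^ 3 ∧
    ‖Complex.exp (x * Complex.I) - (1 + x * Complex.I - (x : ℂ) ^ 2 / 2)‖ ≤ 4 * x ^ 2 := by
  have hx : 0 ≤ |x| := abs_nonneg x
  rw [← sq_abs x]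
  -- The power series remainder serves for `|x| ≤ 1`; beyond that the triangle inequality suffices,
  -- as `2 + |x| + x² / 2 ≤ 4 x²`.
  rcases le_total |x| 1 with h | h
  · have hb := Complex.exp_bound (x := x * Complex.I) (by simpa using h) (n := 3) (by norm_num)
    have e : ∑ m ∈ Finset.range 3, (x * Complex.I) ^ m / (m.factorial : ℂ) =
        1 + x * Complex.I - (x : ℂ) ^ 2 / 2 := by
      simp [Finset.sum_range_succ, mul_pow, Nat.factorial]
      ring
    rw [e] at hb
    have hb' : ‖Complex.exp (x * Complex.I) - (1 + x * Complex.I - (x : ℂ) ^ 2 / 2)‖ ≤ |x| ^ 3 := by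
      refine hb.trans ?_
      have : ‖(x : ℂ) * Complex.I‖ = |x| := by simp
      rw [this]
      have : 0 ≤ |x| ^ 3 := by positivity
      norm_num [Nat.factorial]
      linarith
    have : |x| ^ 3 ≤ |x| ^ 2 := pow_le_pow_of_le_one hx h (by norm_num)
    constructor <;> nlinarith [pow_nonneg hx 3]
  · have h1 : ‖Complex.exp (x * Complex.I) - (1 + x * Complex.I - (x : ℂ) ^ 2 / 2)‖ ≤
        4 * |x| ^ 2 := by
      have a1 : ‖Complex.exp (x * Complex.I)‖ = 1 := Complex.norm_exp_ofReal_mul_I x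
      have a2 : ‖(1 : ℂ) + x * Complex.I - (x : ℂ) ^ 2 / 2‖ ≤ 1 + |x| + |x| ^ 2 / 2 := by
        refine (norm_sub_le _ _).trans ?_
        refine add_le_add ((norm_add_le _ _).trans ?_) ?_ <;> simp
      refine (norm_sub_le _ _).trans ?_
      rw [a1]
      nlinarith
    refine ⟨h1.trans ?_, h1⟩
    have : |x| ^ 2 ≤ |x| ^ 3 := pow_le_pow_right₀ h (by norm_num)
    linarith

lemma abs_exp_neg_sub_le {u : ℝ} (hu : 0 ≤ u) : |Real.exp (-u) - (1 - u)| ≤ u ^ 2 := by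
  rcases le_total u 1 with h | h
  · have := Real.abs_exp_sub_one_sub_id_le (x := -u) (by rwa [abs_neg, abs_of_nonneg hu])
    rw [neg_sq] at this
    convert this using 2
    ring
  · rw [abs_of_nonneg (by linarith [Real.add_one_le_exp (-u)])]
    have : Real.exp (-u) ≤ 1 := Real.exp_le_one_iff.2 (by linarith)
    nlinarith

/-- Replacing one factor at a time costs only the change in that factor, since all the others lie in
the unit disc. -/
lemma norm_prod_sub_prod_le_sum {ι : Type*} (s : Finset ι) (f g : ι → ℂ)
    (hf : ∀ i, ‖f i‖ ≤ 1) (hg : ∀ i, ‖g i‖ ≤ 1) :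
    ‖∏ i ∈ s, f i - ∏ i ∈ s, g i‖ ≤ ∑ i ∈ s, ‖f i - g i‖ := by
  classical
  induction s using Finset.induction_on with
  | empty => simp
  | insert a s ha ih =>
    rw [Finset.prod_insert ha, Finset.prod_insert ha, Finset.sum_insert ha]
    have e : f a * ∏ i ∈ s, f i - g a * ∏ i ∈ s, g i =
        (f a - g a) * ∏ i ∈ s, f i + g a * (∏ i ∈ s, f i - ∏ i ∈ s, g i) := by ring
    rw [e]
    have h1 : ‖∏ i ∈ s, f i‖ ≤ 1 := by
      rw [norm_prod]
      exact Finset.prod_le_one (fun i _ => norm_nonneg _) fun i _ => hf i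
    refine (norm_add_le _ _).trans (add_le_add ?_ ?_)
    · rw [norm_mul]
      exact mul_le_of_le_one_right (norm_nonneg _) h1
    · rw [norm_mul]
      exact (mul_le_of_le_one_left (norm_nonneg _) (hg a)).trans ih

variable {Ω : Type*} [MeasurableSpace Ω] {P : Measure Ω}

/-- The part of the second moment of `X` carried by the event `η < |X|`. -/
def tailMoment (P : Measure Ω) (X : Ω → ℝ) (η : ℝ) : ℝ :=
  ∫ ω, {ω | η < |X ω|}.indicator (fun ω => X ω ^ 2) ω ∂P

lemma tailMoment_nonneg (X : Ω → ℝ) (η : ℝ) : 0 ≤ tailMoment P X η :=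
  integral_nonneg fun ω => Set.indicator_nonneg (fun _ _ => sq_nonneg _) ω

lemma integrable_tailMoment {X : Ω → ℝ} (hX : Measurable X) (hX2 : MemLp X 2 P) (η : ℝ) :
    Integrable (fun ω => {ω | η < |X ω|}.indicator (fun ω => X ω ^ 2) ω) P :=
  hX2.integrable_sq.indicator (measurableSet_lt measurable_const (by fun_prop))

lemma integral_sq_le_add_tailMoment [IsProbabilityMeasure P] {X : Ω → ℝ} (hX : Measurable X)
    (hX2 : MemLp X 2 P) {η : ℝ} :
    ∫ ω, X ω ^ 2 ∂P ≤ η ^ 2 + tailMoment P X η := by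
  have : ∫ ω, X ω ^ 2 ∂P ≤
      ∫ ω, (η ^ 2 + {ω | η < |X ω|}.indicator (fun ω => X ω ^ 2) ω) ∂P := by
    refine integral_mono hX2.integrable_sq
      ((integrable_const _).add (integrable_tailMoment hX hX2 η)) fun ω => ?_
    by_cases h : η < |X ω|
    · simp [Set.indicator, h]; positivity
    · simp only [Set.indicator, Set.mem_ofPred_eq, h, if_false, add_zero]
      rw [← sq_abs]
      exact pow_le_pow_left₀ (abs_nonneg _) (not_lt.1 h) 2
  rwa [integral_add (integrable_const _) (integrable_tailMoment hX hX2 η), integral_const,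
    probReal_univ, one_smul] at this

/-- Both characteristic functions are compared with `1 - t² v / 2`. The Taylor remainder is cubic
where `|X| ≤ η`, hence at most a multiple of `η X²`, and quadratic on the tail. The bound is a sum
of multiples of the variance and of the tail moment, so that it can be summed over a row. -/
lemma norm_charFun_sub_exp_le [IsProbabilityMeasure P] {X : Ω → ℝ} (hX : Measurable X)
    (hX2 : MemLp X 2 P) (h0 : ∫ ω, X ω ∂P = 0) {η : ℝ} (hη : 0 ≤ η) (t : ℝ) :
    ‖charFun (P.map X) t - Complex.exp (-(t ^ 2 * ∫ ω, X ω ^ 2 ∂P : ℝ) / 2)‖ ≤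
      4 * |t| ^ 3 * η * ∫ ω, X ω ^ 2 ∂P + 4 * t ^ 2 * tailMoment P X η +
      t ^ 4 * (η ^ 2 + tailMoment P X η) * ∫ ω, X ω ^ 2 ∂P := by
  set v := ∫ ω, X ω ^ 2 ∂P with hv
  have hv0 : 0 ≤ v := integral_nonneg fun ω => sq_nonneg _
  have hX1 : Integrable X P := hX2.integrable one_le_two
  have hsq := hX2.integrable_sq
  have hcf : charFun (P.map X) t = ∫ ω, Complex.exp ((t * X ω : ℝ) * Complex.I) ∂P := by
    rw [charFun_apply_real, integral_map hX.aemeasurable (by fun_prop)]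
    simp
  have hie : Integrable (fun ω => Complex.exp ((t * X ω : ℝ) * Complex.I)) P := by
    refine Integrable.of_bound (C := 1) (by fun_prop) (ae_of_all _ fun ω => ?_)
    rw [Complex.norm_exp_ofReal_mul_I]
  have hit : Integrable (fun ω => (1 + (t * X ω : ℝ) * Complex.I -
      ((t * X ω : ℝ) : ℂ) ^ 2 / 2 : ℂ)) P := by
    refine ((integrable_const _).add ((hX1.const_mul t).ofReal.mul_const _)).sub ?_
    have := (hsq.const_mul (t ^ 2)).ofReal (𝕜 := ℂ)
    refine (this.div_const 2).congr (ae_of_all _ fun ω => ?_)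
    simp [mul_pow]
  have hI : ∫ ω, (1 + (t * X ω : ℝ) * Complex.I - ((t * X ω : ℝ) : ℂ) ^ 2 / 2 : ℂ) ∂P =
      ((1 - t ^ 2 * v / 2 : ℝ) : ℂ) := by
    have e : ∀ ω, (1 + (t * X ω : ℝ) * Complex.I - ((t * X ω : ℝ) : ℂ) ^ 2 / 2 : ℂ) =
        (1 + (t * X ω : ℝ) * Complex.I) - ((t ^ 2 / 2 * X ω ^ 2 : ℝ) : ℂ) := by
      intro ω; push_cast; ring
    simp_rw [e]
    rw [integral_sub, integral_add, integral_mul_const, integral_complex_ofReal, integral_complex_ofReal,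
      integral_const_mul, integral_const_mul, h0, ← hv]
    · simp; ring
    · exact integrable_const _
    · exact ((hX1.const_mul t).ofReal.mul_const _)
    · exact (integrable_const _).add ((hX1.const_mul t).ofReal.mul_const _)
    · exact (hsq.const_mul _).ofReal
  have h1 : ‖charFun (P.map X) t - ((1 - t ^ 2 * v / 2 : ℝ) : ℂ)‖ ≤
      4 * |t| ^ 3 * η * v + 4 * t ^ 2 * tailMoment P X η := by
    rw [hcf, ← hI, ← integral_sub hie hit]
    have hdom : Integrable (fun ω => 4 * |t| ^ 3 * η * X ω ^ 2 +
        4 * t ^ 2 * {ω | η < |X ω|}.indicator (fun ω => X ω ^ 2) ω) P :=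
      (hsq.const_mul _).add ((integrable_tailMoment hX hX2 η).const_mul _)
    refine (norm_integral_le_of_norm_le hdom (ae_of_all _ fun ω => ?_)).trans_eq ?_
    · obtain ⟨b1, b2⟩ := norm_cexp_sub_taylor_le (t * X ω)
      by_cases h : η < |X ω|
      · refine b2.trans ?_
        simp only [Set.indicator, Set.mem_ofPred_eq, h, if_true]
        have : 0 ≤ 4 * |t| ^ 3 * η * X ω ^ 2 := by positivity
        nlinarith
      · refine b1.trans ?_
        simp only [Set.indicator, Set.mem_ofPred_eq, h, if_false, mul_zero, add_zero]
        rw [abs_mul, mul_pow, ← sq_abs (X ω)]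
        have : |X ω| ^ 3 ≤ η * |X ω| ^ 2 := by
          rw [pow_succ' |X ω| 2]
          exact mul_le_mul_of_nonneg_right (not_lt.1 h) (by positivity)
        calc 4 * (|t| ^ 3 * |X ω| ^ 3) ≤ 4 * (|t| ^ 3 * (η * |X ω| ^ 2)) := by gcongr
          _ = _ := by ring
    · rw [integral_add (hsq.const_mul _) ((integrable_tailMoment hX hX2 η).const_mul _),
        integral_const_mul, integral_const_mul, tailMoment]
  have h2 : ‖((1 - t ^ 2 * v / 2 : ℝ) : ℂ) - Complex.exp (-(t ^ 2 * v : ℝ) / 2)‖ ≤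
      t ^ 4 * (η ^ 2 + tailMoment P X η) * v := by
    have e : Complex.exp (-(t ^ 2 * v : ℝ) / 2) = ((Real.exp (-(t ^ 2 * v / 2)) : ℝ) : ℂ) := by
      rw [Complex.ofReal_exp]; congr 1; push_cast; ring
    rw [e, ← Complex.ofReal_sub, Complex.norm_real, Real.norm_eq_abs, abs_sub_comm]
    refine (abs_exp_neg_sub_le (by positivity)).trans ?_
    have hvle := integral_sq_le_add_tailMoment hX hX2 (η := η)
    rw [← hv] at hvle
    -- Only one of the two factors `v` is bounded by `η ^ 2` plus the tail; the other is kept for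
    -- the summation over the row.
    calc (t ^ 2 * v / 2) ^ 2 = t ^ 4 * v * v / 4 := by ring
      _ ≤ t ^ 4 * v * v := by
        have : 0 ≤ t ^ 4 * v * v := by positivity
        linarith
      _ ≤ _ := by gcongr
  calc _ ≤ _ := norm_sub_le_norm_sub_add_norm_sub _ ((1 - t ^ 2 * v / 2 : ℝ) : ℂ) _
    _ ≤ _ := add_le_add h1 h2

/-! ### Sums of independent variables in one row -/

section Sum

variable {ι : Type*} [Fintype ι] {a : ι → Ω → ℝ}

lemma norm_charFun_sum_sub_exp_le [IsProbabilityMeasure P] (ha : ∀ i, Measurable (a i))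
    (hind : iIndepFun a P) (ha2 : ∀ i, MemLp (a i) 2 P) (h0 : ∀ i, ∫ ω, a i ω ∂P = 0)
    (h1 : ∑ i, ∫ ω, a i ω ^ 2 ∂P = 1) {η : ℝ} (hη : 0 ≤ η) (t : ℝ) :
    ‖charFun (P.map fun ω => ∑ i, a i ω) t - Complex.exp (-(t : ℂ) ^ 2 / 2)‖ ≤
      4 * |t| ^ 3 * η + t ^ 4 * η ^ 2 + (4 * t ^ 2 + t ^ 4) * ∑ i, tailMoment P (a i) η := by
  have hv0 : ∀ i, 0 ≤ ∫ ω, a i ω ^ 2 ∂P := fun i => integral_nonneg fun ω => sq_nonneg _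
  rw [hind.charFun_map_fun_sum_eq_prod fun i => (ha i).aemeasurable, Finset.prod_apply]
  -- As the variances sum to one, the Gaussian limit splits into factors matching the summands.
  have e : Complex.exp (-(t : ℂ) ^ 2 / 2) =
      ∏ i, Complex.exp (-(t ^ 2 * ∫ ω, a i ω ^ 2 ∂P : ℝ) / 2) := by
    rw [← Complex.exp_sum]
    congr 1
    rw [← Finset.sum_div, Finset.sum_neg_distrib, ← Complex.ofReal_sum, ← Finset.mul_sum, h1]
    simp
  rw [e]
  refine (norm_prod_sub_prod_le_sum _ _ _ (fun i => ?_) fun i => ?_).trans ?_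
  · have := Measure.isProbabilityMeasure_map (μ := P) (ha i).aemeasurable
    exact norm_charFun_le_one t
  · rw [Complex.norm_exp, Real.exp_le_one_iff]
    have := hv0 i
    have e2 : (-((t ^ 2 * ∫ ω, a i ω ^ 2 ∂P : ℝ) : ℂ) / 2).re = -(t ^ 2 * ∫ ω, a i ω ^ 2 ∂P) / 2 := by
      rw [← Complex.ofReal_neg]
      exact Complex.div_ofNat_re _ _
    rw [e2]
    have : 0 ≤ t ^ 2 * ∫ ω, a i ω ^ 2 ∂P := by positivity
    linarith
  -- Enlarging each tail to `Λ` inside the product with the variance makes that coefficient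
  -- independent of `i`.
  · set Λ := ∑ i, tailMoment P (a i) η with hΛ
    have hle : ∀ i, tailMoment P (a i) η ≤ Λ := fun i =>
      Finset.single_le_sum (f := fun i => tailMoment P (a i) η)
        (fun j _ => tailMoment_nonneg _ _) (Finset.mem_univ i)
    calc _ ≤ ∑ i, (4 * |t| ^ 3 * η * ∫ ω, a i ω ^ 2 ∂P + 4 * t ^ 2 * tailMoment P (a i) η +
          t ^ 4 * (η ^ 2 + Λ) * ∫ ω, a i ω ^ 2 ∂P) := by
          refine Finset.sum_le_sum fun i _ =>
            (norm_charFun_sub_exp_le (ha i) (ha2 i) (h0 i) hη t).trans ?_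
          have := hle i
          have := hv0 i
          gcongr
      _ = _ := by
          rw [Finset.sum_add_distrib, Finset.sum_add_distrib, ← Finset.mul_sum, ← Finset.mul_sum,
            ← Finset.mul_sum, h1, ← hΛ]
          ring

/-! ### Law of large numbers in `L¹` for the sum of squares -/

lemma integral_abs_le_of_integral_sq_le [IsProbabilityMeasure P] {X : Ω → ℝ}
    (hX2 : MemLp X 2 P) {η : ℝ} (hη : 0 < η) (h : ∫ ω, X ω ^ 2 ∂P ≤ η ^ 2) :
    ∫ ω, |X ω| ∂P ≤ η := by
  have hle : ∫ ω, |X ω| ∂P ≤ ∫ ω, (η / 2 + (2 * η)⁻¹ * X ω ^ 2) ∂P := by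
    refine integral_mono (hX2.integrable one_le_two).abs
      ((integrable_const _).add (hX2.integrable_sq.const_mul _)) fun ω => ?_
    have : η / 2 + (2 * η)⁻¹ * X ω ^ 2 - |X ω| = (2 * η)⁻¹ * (|X ω| - η) ^ 2 := by
      rw [← sq_abs (X ω)]; field_simp; ring
    have h2 : 0 ≤ (2 * η)⁻¹ * (|X ω| - η) ^ 2 := by positivity
    simp only
    linarith
  rw [integral_add (integrable_const _) (hX2.integrable_sq.const_mul _), integral_const,
    probReal_univ, one_smul, integral_const_mul] at hle
  refine hle.trans ?_
  calc η / 2 + (2 * η)⁻¹ * ∫ ω, X ω ^ 2 ∂P ≤ η / 2 + (2 * η)⁻¹ * η ^ 2 := by gcongr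
    _ = η := by field_simp; norm_num

/-- The square of `x`, cut off to zero for `η < |x|`. -/
def truncSq (η x : ℝ) : ℝ := {x : ℝ | |x| ≤ η}.indicator (fun x => x ^ 2) x

lemma measurable_truncSq (η : ℝ) : Measurable (truncSq η) :=
  (by fun_prop : Measurable fun x : ℝ => x ^ 2).indicator
    (measurableSet_le (by fun_prop) measurable_const)

lemma truncSq_nonneg (η x : ℝ) : 0 ≤ truncSq η x :=
  Set.indicator_nonneg (fun _ _ => sq_nonneg _) x

lemma sq_truncSq_le (η x : ℝ) : truncSq η x ^ 2 ≤ η ^ 2 * x ^ 2 := by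
  unfold truncSq
  by_cases h : |x| ≤ η
  · simp only [Set.indicator, Set.mem_ofPred_eq, h, if_true]
    have : x ^ 2 ≤ η ^ 2 := by
      rw [← sq_abs]; exact pow_le_pow_left₀ (abs_nonneg _) h 2
    nlinarith [sq_nonneg x]
  · simp only [Set.indicator, Set.mem_ofPred_eq, h, if_false]
    rw [zero_pow two_ne_zero]
    positivity

lemma truncSq_le (η x : ℝ) : truncSq η x ≤ η ^ 2 := by
  unfold truncSq
  by_cases h : |x| ≤ η
  · simp only [Set.indicator, Set.mem_ofPred_eq, h, if_true]
    rw [← sq_abs]; exact pow_le_pow_left₀ (abs_nonneg _) h 2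
  · simp only [Set.indicator, Set.mem_ofPred_eq, h, if_false]
    positivity

lemma sq_eq_truncSq_add {Ω : Type*} (X : Ω → ℝ) (η : ℝ) (ω : Ω) :
    X ω ^ 2 = truncSq η (X ω) + {ω | η < |X ω|}.indicator (fun ω => X ω ^ 2) ω := by
  unfold truncSq
  by_cases h : |X ω| ≤ η
  · simp [Set.indicator, h, not_lt.2 h]
  · simp [Set.indicator, h, not_le.1 h]

lemma memLp_truncSq [IsProbabilityMeasure P] {X : Ω → ℝ} (hX : Measurable X) (η : ℝ)
    (q : ℝ≥0∞) : MemLp (fun ω => truncSq η (X ω)) q P := by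
  refine MemLp.of_bound ((measurable_truncSq η).comp hX).aestronglyMeasurable (η ^ 2)
    (ae_of_all _ fun ω => ?_)
  rw [Real.norm_eq_abs, abs_of_nonneg (truncSq_nonneg _ _)]
  exact truncSq_le _ _

/-- Squares need not have a variance, so they are truncated at `η`. The truncated sum `B` has
variance at most `η ^ 2` because `truncSq η x ^ 2 ≤ η ^ 2 * x ^ 2`. The remainder `R` counts twice:
for itself, and for the shift of the mean of `B` away from one. -/
lemma integral_abs_sum_sq_sub_one_le [IsProbabilityMeasure P] (ha : ∀ i, Measurable (a i))
    (hind : iIndepFun a P) (ha2 : ∀ i, MemLp (a i) 2 P)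
    (h1 : ∑ i, ∫ ω, a i ω ^ 2 ∂P = 1) {η : ℝ} (hη : 0 < η) :
    ∫ ω, |∑ i, a i ω ^ 2 - 1| ∂P ≤ η + 2 * ∑ i, tailMoment P (a i) η := by
  set B : Ω → ℝ := fun ω => ∑ i, truncSq η (a i ω) with hB
  have hBm : MemLp B 2 P := memLp_finsetSum _ fun i _ => memLp_truncSq (ha i) η 2
  have hvar : Var[B; P] ≤ η ^ 2 := by
    have e : B = ∑ i, fun ω => truncSq η (a i ω) := by ext ω; simp [hB]
    rw [e, IndepFun.variance_sum (fun i _ => memLp_truncSq (ha i) η 2)]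
    · calc _ ≤ ∑ i, η ^ 2 * ∫ ω, a i ω ^ 2 ∂P := by
            refine Finset.sum_le_sum fun i _ => ?_
            refine (variance_le_expectation_sq
              (memLp_truncSq (P := P) (ha i) η 2).aestronglyMeasurable).trans ?_
            rw [← integral_const_mul]
            exact integral_mono (memLp_truncSq (ha i) η 2).integrable_sq
              ((ha2 i).integrable_sq.const_mul _) fun ω => sq_truncSq_le η _
        _ = η ^ 2 := by rw [← Finset.mul_sum, h1, mul_one]
    · intro i _ j _ hij
      exact (hind.indepFun hij).comp (measurable_truncSq η) (measurable_truncSq η)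
  have hBI : ∫ ω, |B ω - ∫ ω, B ω ∂P| ∂P ≤ η := by
    refine integral_abs_le_of_integral_sq_le (hBm.sub (memLp_const _)) hη ?_
    rwa [variance_eq_integral hBm.aestronglyMeasurable.aemeasurable] at hvar
  set R : Ω → ℝ := fun ω => ∑ i, {ω | η < |a i ω|}.indicator (fun ω => a i ω ^ 2) ω with hR
  have hRi : Integrable R P :=
    integrable_finsetSum _ fun i _ => integrable_tailMoment (ha i) (ha2 i) η
  have hRI : ∫ ω, R ω ∂P = ∑ i, tailMoment P (a i) η :=
    integral_finsetSum _ fun i _ => integrable_tailMoment (ha i) (ha2 i) η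
  have hR0 : ∀ ω, 0 ≤ R ω := fun ω =>
    Finset.sum_nonneg fun i _ => Set.indicator_nonneg (fun _ _ => sq_nonneg _) ω
  have hsum : ∀ ω, ∑ i, a i ω ^ 2 = B ω + R ω := fun ω => by
    rw [hB, hR, ← Finset.sum_add_distrib]
    exact Finset.sum_congr rfl fun i _ => sq_eq_truncSq_add (a i) η ω
  have hBi : Integrable B P := hBm.integrable one_le_two
  have hEB : ∫ ω, B ω ∂P = 1 - ∫ ω, R ω ∂P := by
    have : ∫ ω, (B ω + R ω) ∂P = 1 := by
      simp_rw [← hsum]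
      rw [integral_finsetSum _ fun i _ => (ha2 i).integrable_sq, h1]
    rw [integral_add hBi hRi] at this
    linarith
  have hRI0 : 0 ≤ ∫ ω, R ω ∂P := integral_nonneg hR0
  have i1 : Integrable (fun ω => |B ω - ∫ ω, B ω ∂P|) P := (hBi.sub (integrable_const _)).abs
  calc ∫ ω, |∑ i, a i ω ^ 2 - 1| ∂P
      ≤ ∫ ω, (|B ω - ∫ ω, B ω ∂P| + R ω + ∫ ω, R ω ∂P) ∂P := by
        refine integral_mono ?_ ((i1.add hRi).add (integrable_const _)) fun ω => ?_
        · simp_rw [hsum]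
          exact ((hBi.add hRi).sub (integrable_const _)).abs
        · simp only [hsum]
          rw [hEB]
          have := hR0 ω
          refine abs_le.2 ⟨?_, ?_⟩
          · linarith [neg_abs_le (B ω - (1 - ∫ ω, R ω ∂P))]
          · linarith [le_abs_self (B ω - (1 - ∫ ω, R ω ∂P))]
    _ = ∫ ω, |B ω - ∫ ω, B ω ∂P| ∂P + ∫ ω, R ω ∂P + ∫ ω, R ω ∂P := by
        have i2 : Integrable (fun ω => |B ω - ∫ ω, B ω ∂P| + R ω) P := i1.add hRi
        rw [integral_add i2 (integrable_const _), integral_add i1 hRi, integral_const,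
          probReal_univ, one_smul]
    _ ≤ _ := by rw [hRI] at *; linarith

lemma integral_sum_sq_eq_one [IsProbabilityMeasure P]
    (hind : iIndepFun a P) (ha2 : ∀ i, MemLp (a i) 2 P) (h0 : ∀ i, ∫ ω, a i ω ∂P = 0)
    (h1 : ∑ i, ∫ ω, a i ω ^ 2 ∂P = 1) : ∫ ω, (∑ i, a i ω) ^ 2 ∂P = 1 := by
  have e : (fun ω => ∑ i, a i ω) = ∑ i, a i := by ext ω; simp
  have hm : ∫ ω, ∑ i, a i ω ∂P = 0 := by
    rw [integral_finsetSum _ fun i _ => (ha2 i).integrable one_le_two]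
    simp [h0]
  have hS : MemLp (fun ω => ∑ i, a i ω) 2 P := memLp_finsetSum _ fun i _ => ha2 i
  have := IndepFun.variance_sum (s := Finset.univ) (fun i _ => ha2 i)
    (fun i _ j _ hij => hind.indepFun hij)
  rw [← e, variance_of_integral_eq_zero hS.aestronglyMeasurable.aemeasurable hm] at this
  rw [this, ← h1]
  exact Finset.sum_congr rfl fun i _ =>
    variance_of_integral_eq_zero (ha2 i).aestronglyMeasurable.aemeasurable (h0 i)

end Sum

end OneRow

/-! ### Triangular arrays -/

lemma continuous_cdf_of_nullSingleton (ν : Measure ℝ) [IsProbabilityMeasure ν]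
    (hν : ∀ x, ν {x} = 0) : Continuous (cdf ν) := by
  refine continuous_iff_continuousAt.2 fun x => continuousAt_iff_continuous_left_right.2 ⟨?_, ?_⟩
  · have h := (cdf ν).measure_singleton x
    rw [measure_cdf, hν, eq_comm, ENNReal.ofReal_eq_zero] at h
    have hle := (cdf ν).mono.leftLim_le le_rfl (x := x)
    have h2 : Function.leftLim (cdf ν) x = cdf ν x := le_antisymm hle (by linarith)
    exact continuousWithinAt_Iio_iff_Iic.1
      ((cdf ν).mono.continuousWithinAt_Iio_iff_leftLim_eq.2 h2)
  · exact (cdf ν).right_continuous x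

lemma continuous_cdf_gaussianReal : Continuous (cdf (gaussianReal 0 1)) :=
  have := nullSingletonClass_gaussianReal (μ := 0) one_ne_zero
  continuous_cdf_of_nullSingleton _ fun x => measure_singleton x

lemma strictMono_cdf_gaussianReal : StrictMono (cdf (gaussianReal 0 1)) := by
  intro x y hxy
  rw [cdf_eq_real, cdf_eq_real, ← Set.Iic_union_Ioc_eq_Iic hxy.le,
    measureReal_union (Set.Iic_disjoint_Ioc le_rfl) measurableSet_Ioc]
  have : 0 < (gaussianReal 0 1).real (Set.Ioc x y) := by
    refine ENNReal.toReal_pos (fun h => ?_) (measure_ne_top _ _)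
    -- Lebesgue measure is absolutely continuous with respect to the Gaussian, so a Gaussian-null
    -- interval would have length zero.
    have := gaussianReal_absolutelyContinuous' 0 one_ne_zero h
    simp at this
    linarith
  linarith

/-- The truncation level `η` is fixed first to make `g η` small; only then does `k` grow. -/
lemma tendsto_zero_of_le_add {f : ℕ → ℝ} {g : ℝ → ℝ} {h : ℝ → ℕ → ℝ} (hf : ∀ k, 0 ≤ f k)
    (hle : ∀ η > 0, ∀ k, f k ≤ g η + h η k) (hg : Tendsto g (𝓝[>] 0) (𝓝 0))
    (hh : ∀ η > 0, Tendsto (h η) atTop (𝓝 0)) : Tendsto f atTop (𝓝 0) := by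
  refine tendsto_order.2 ⟨fun b hb => Eventually.of_forall fun k => hb.trans_le (hf k),
    fun b hb => ?_⟩
  obtain ⟨η, h1, h2⟩ := ((hg.eventually_lt_const (half_pos hb)).and self_mem_nhdsWithin).exists
  filter_upwards [(hh η h2).eventually_lt_const (half_pos hb)] with k hk
  linarith [hle η h2 k]

section TriangularArray

variable {Ω : ℕ → Type*} [∀ k, MeasurableSpace (Ω k)] {P : ∀ k, Measure (Ω k)}
  [∀ k, IsProbabilityMeasure (P k)] {ι : ℕ → Type*} [∀ k, Fintype (ι k)]
  {a : ∀ k, ι k → Ω k → ℝ}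

/-- **Lindeberg's central limit theorem** for triangular arrays. -/
theorem tendsto_measureReal_sum_le_of_lindeberg (ha : ∀ k i, Measurable (a k i))
    (hind : ∀ k, iIndepFun (a k) (P k)) (ha2 : ∀ k i, MemLp (a k i) 2 (P k))
    (h0 : ∀ k i, ∫ ω, a k i ω ∂(P k) = 0) (h1 : ∀ k, ∑ i, ∫ ω, a k i ω ^ 2 ∂(P k) = 1)
    (hL : ∀ η > 0, Tendsto (fun k => ∑ i, tailMoment (P k) (a k i) η) atTop (𝓝 0)) (t : ℝ) :
    Tendsto (fun k => (P k).real {ω | ∑ i, a k i ω ≤ t}) atTop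
      (𝓝 (cdf (gaussianReal 0 1) t)) := by
  have hm : ∀ k, Measurable fun ω => ∑ i, a k i ω := fun k =>
    Finset.measurable_fun_sum _ fun i _ => ha k i
  let μ : ℕ → ProbabilityMeasure ℝ := fun k =>
    ⟨(P k).map fun ω => ∑ i, a k i ω, Measure.isProbabilityMeasure_map (hm k).aemeasurable⟩
  let ν : ProbabilityMeasure ℝ := ⟨gaussianReal 0 1, inferInstance⟩
  have hconv : Tendsto μ atTop (𝓝 ν) := by
    refine ProbabilityMeasure.tendsto_iff_tendsto_charFun.2 fun s => ?_
    have e : charFun (ν : Measure ℝ) s = Complex.exp (-(s : ℂ) ^ 2 / 2) := by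
      change charFun (gaussianReal 0 1) s = _
      rw [charFun_gaussianReal]
      congr 1
      simp
      ring
    rw [e, tendsto_iff_norm_sub_tendsto_zero]
    refine tendsto_zero_of_le_add (g := fun η => 4 * |s| ^ 3 * η + s ^ 4 * η ^ 2)
      (h := fun η k => (4 * s ^ 2 + s ^ 4) * ∑ i, tailMoment (P k) (a k i) η)
      (fun k => norm_nonneg _) (fun η hη k => ?_) ?_ fun η hη => ?_
    · exact norm_charFun_sum_sub_exp_le (ha k) (hind k) (ha2 k) (h0 k) (h1 k) hη.le s
    · have : Continuous fun η : ℝ => 4 * |s| ^ 3 * η + s ^ 4 * η ^ 2 := by fun_prop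
      simpa using (this.tendsto 0).mono_left nhdsWithin_le_nhds
    · simpa using (hL η hη).const_mul (4 * s ^ 2 + s ^ 4)
  have hfr : (ν : Measure ℝ) (frontier (Set.Iic t)) = 0 := by
    have := nullSingletonClass_gaussianReal (μ := 0) one_ne_zero
    rw [frontier_Iic]
    exact measure_singleton (μ := gaussianReal 0 1) t
  have := ProbabilityMeasure.tendsto_measure_of_null_frontier_of_tendsto' hconv hfr
  have h2 := (ENNReal.tendsto_toReal (measure_ne_top _ _)).comp this
  rw [cdf_eq_real]
  refine h2.congr fun k => ?_
  change ((P k).map _).real _ = _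
  rw [map_measureReal_apply (hm k) measurableSet_Iic]
  rfl

/-- Self-normalized version of Lindeberg's central limit theorem, with centering of the empirical
second moment. -/
theorem tendsto_measureReal_selfNormalized_le_of_lindeberg (ha : ∀ k i, Measurable (a k i))
    (hind : ∀ k, iIndepFun (a k) (P k)) (ha2 : ∀ k i, MemLp (a k i) 2 (P k))
    (h0 : ∀ k i, ∫ ω, a k i ω ∂(P k) = 0) (h1 : ∀ k, ∑ i, ∫ ω, a k i ω ^ 2 ∂(P k) = 1)
    (hL : ∀ η > 0, Tendsto (fun k => ∑ i, tailMoment (P k) (a k i) η) atTop (𝓝 0))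
    {r : ℕ → ℝ} (hr0 : ∀ k, 0 ≤ r k) (hr : Tendsto r atTop (𝓝 0)) (t : ℝ) :
    Tendsto (fun k => (P k).real
      {ω | (∑ i, a k i ω) / √(∑ i, a k i ω ^ 2 - r k * (∑ i, a k i ω) ^ 2) ≤ t}) atTop
      (𝓝 (cdf (gaussianReal 0 1) t)) := by
  set S : ∀ k, Ω k → ℝ := fun k ω => ∑ i, a k i ω with hS
  set D : ∀ k, Ω k → ℝ := fun k ω => ∑ i, a k i ω ^ 2 - r k * S k ω ^ 2 with hD
  have hS2 : ∀ k, MemLp (S k) 2 (P k) := fun k => memLp_finsetSum _ fun i _ => ha2 k i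
  have hQi : ∀ k, Integrable (fun ω => ∑ i, a k i ω ^ 2) (P k) := fun k =>
    integrable_finsetSum _ fun i _ => (ha2 k i).integrable_sq
  have hDi : ∀ k, Integrable (D k) (P k) := fun k =>
    (hQi k).sub ((hS2 k).integrable_sq.const_mul _)
  have hD1i : ∀ k, Integrable (fun ω => |D k ω - 1|) (P k) := fun k =>
    ((hDi k).sub (integrable_const 1)).abs
  -- The centering correction `r k * S k ω ^ 2` has integral `r k`, as the row sum has second moment
  -- one.
  have hDL : Tendsto (fun k => ∫ ω, |D k ω - 1| ∂(P k)) atTop (𝓝 0) := by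
    refine tendsto_zero_of_le_add (g := fun η => η)
      (h := fun η k => 2 * ∑ i, tailMoment (P k) (a k i) η + r k)
      (fun k => integral_nonneg fun ω => abs_nonneg _) (fun η hη k => ?_)
      (tendsto_id.mono_left nhdsWithin_le_nhds) fun η hη => by
        simpa using ((hL η hη).const_mul 2).add hr
    have i1 : Integrable (fun ω => |∑ i, a k i ω ^ 2 - 1|) (P k) :=
      ((hQi k).sub (integrable_const 1)).abs
    have i2 : Integrable (fun ω => r k * S k ω ^ 2) (P k) := (hS2 k).integrable_sq.const_mul _
    calc ∫ ω, |D k ω - 1| ∂(P k)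
        ≤ ∫ ω, (|∑ i, a k i ω ^ 2 - 1| + r k * S k ω ^ 2) ∂(P k) := by
          refine integral_mono (hD1i k) (i1.add i2) fun ω => ?_
          have h3 : 0 ≤ r k * S k ω ^ 2 := mul_nonneg (hr0 k) (sq_nonneg _)
          simp only [hD]
          refine abs_le.2 ⟨?_, ?_⟩
          · linarith [neg_abs_le (∑ i, a k i ω ^ 2 - 1)]
          · linarith [le_abs_self (∑ i, a k i ω ^ 2 - 1)]
      _ ≤ (η + 2 * ∑ i, tailMoment (P k) (a k i) η) + r k * 1 := by
          rw [integral_add i1 i2, integral_const_mul,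
            integral_sum_sq_eq_one (hind k) (ha2 k) (h0 k) (h1 k)]
          gcongr
          exact integral_abs_sum_sq_sub_one_le (ha k) (hind k) (ha2 k) (h1 k) hη
      _ = _ := by ring
  have hprob : ∀ γ > 0, Tendsto (fun k => (P k).real {ω | γ ≤ |D k ω - 1|}) atTop (𝓝 0) := by
    intro γ hγ
    have hlim : Tendsto (fun k => γ⁻¹ * ∫ ω, |D k ω - 1| ∂(P k)) atTop (𝓝 0) := by
      simpa using hDL.const_mul γ⁻¹
    refine squeeze_zero (fun k => measureReal_nonneg) (fun k => ?_) hlim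
    rw [← div_eq_inv_mul, le_div_iff₀' hγ]
    exact mul_meas_ge_le_integral_of_nonneg (ae_of_all _ fun ω => abs_nonneg _) (hD1i k) γ
  have hsqrt : ∀ {x γ : ℝ}, γ < 1 → |x - 1| < γ → 0 < √x ∧ |√x - 1| < γ := by
    intro x γ hγ hx
    have hx0 : 0 < x := by linarith [(abs_lt.1 hx).1]
    have hs := Real.sqrt_pos.2 hx0
    refine ⟨hs, lt_of_le_of_lt ?_ hx⟩
    have e : x - 1 = (√x - 1) * (√x + 1) := by
      have := Real.mul_self_sqrt hx0.le
      linarith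
    rw [e, abs_mul, abs_of_pos (by linarith : 0 < √x + 1)]
    nlinarith [abs_nonneg (√x - 1)]
  -- Slutsky by hand: if `|D - 1| < γ < 1`, then `√D` is positive and within `γ` of one, so clearing
  -- the denominator moves the threshold `t` by at most `|t| * γ`.
  have key : ∀ γ : ℝ, γ < 1 → ∀ k,
      (P k).real {ω | S k ω / √(D k ω) ≤ t} ≤
        (P k).real {ω | S k ω ≤ t + |t| * γ} + (P k).real {ω | γ ≤ |D k ω - 1|} ∧
      (P k).real {ω | S k ω ≤ t - |t| * γ} ≤
        (P k).real {ω | S k ω / √(D k ω) ≤ t} + (P k).real {ω | γ ≤ |D k ω - 1|} := by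
    intro γ hγ k
    have hb : ∀ ω, ¬ γ ≤ |D k ω - 1| →
        0 < √(D k ω) ∧ t - |t| * γ ≤ t * √(D k ω) ∧ t * √(D k ω) ≤ t + |t| * γ := by
      intro ω h
      obtain ⟨h2, h3⟩ := hsqrt hγ (not_le.1 h)
      have h4 : |t * (√(D k ω) - 1)| ≤ |t| * γ := by
        rw [abs_mul]
        exact mul_le_mul_of_nonneg_left h3.le (abs_nonneg t)
      have h5 := abs_le.1 h4
      exact ⟨h2, by linarith [h5.1], by linarith [h5.2]⟩
    constructor
    · refine (measureReal_mono fun ω hω => ?_).trans (measureReal_union_le _ _)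
      by_cases h : γ ≤ |D k ω - 1|
      · exact Or.inr h
      · obtain ⟨h2, -, h3⟩ := hb ω h
        exact Or.inl (((div_le_iff₀ h2).1 hω).trans h3)
    · refine (measureReal_mono fun ω hω => ?_).trans (measureReal_union_le _ _)
      by_cases h : γ ≤ |D k ω - 1|
      · exact Or.inr h
      · obtain ⟨h2, h3, -⟩ := hb ω h
        exact Or.inl ((div_le_iff₀ h2).2 (le_trans hω h3))
  have hclt := tendsto_measureReal_sum_le_of_lindeberg ha hind ha2 h0 h1 hL
  have hcont : ∀ c : ℝ, Tendsto (fun γ => cdf (gaussianReal 0 1) (t + c * γ)) (𝓝[>] 0)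
      (𝓝 (cdf (gaussianReal 0 1) t)) := by
    intro c
    have : Continuous fun γ => cdf (gaussianReal 0 1) (t + c * γ) :=
      continuous_cdf_gaussianReal.comp (by fun_prop)
    simpa using (this.tendsto 0).mono_left nhdsWithin_le_nhds
  refine tendsto_order.2 ⟨fun b hb => ?_, fun b hb => ?_⟩
  · obtain ⟨γ, ⟨hγ, hγ1⟩, hγ0⟩ := (((hcont (-|t|)).eventually_const_lt hb).and
      (nhdsWithin_le_nhds (eventually_lt_nhds one_pos)) |>.and self_mem_nhdsWithin).exists
    have := ((hclt (t + -|t| * γ)).sub (hprob γ hγ0)).eventually_const_lt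
      (by simpa using hγ : b < _)
    filter_upwards [this] with k hk
    have := (key γ hγ1 k).2
    rw [show t - |t| * γ = t + -|t| * γ by ring] at this
    linarith
  · obtain ⟨γ, ⟨hγ, hγ1⟩, hγ0⟩ := (((hcont |t|).eventually_lt_const hb).and
      (nhdsWithin_le_nhds (eventually_lt_nhds one_pos)) |>.and self_mem_nhdsWithin).exists
    have := ((hclt (t + |t| * γ)).add (hprob γ hγ0)).eventually_lt_const
      (by simpa using hγ : _ < b)
    filter_upwards [this] with k hk
    have := (key γ hγ1 k).1
    linarith

end TriangularArray

/-! ### Weighted centered coordinates of a product measure -/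

section Coordinates

variable {n : ℕ}

/-- The mean of a vector divided by its standard error. -/
def studentized (w : Fin n → ℝ) : ℝ := (1 / √(n : ℝ) * ∑ i, w i) / √(empVar w)

/-- The products of centered coordinates and weights. -/
def weightedResid (μ : Fin n → Measure ℝ) (c : Fin n → ℝ) (x : Fin n → ℝ) (i : Fin n) : ℝ :=
  (x i - ∫ y, y ∂(μ i)) * c i

/-- The average variance of the products of centered coordinates and weights. -/
def weightedVar (μ : Fin n → Measure ℝ) (c : Fin n → ℝ) : ℝ :=
  1 / (n : ℝ) * ∑ i, variance id (μ i) * c i ^ 2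

/-- The Lyapunov sum of the products of centered coordinates and weights. -/
def weightedLyapunov (δ : ℝ) (μ : Fin n → Measure ℝ) (c : Fin n → ℝ) : ℝ≥0∞ :=
  ENNReal.ofReal (1 / (n : ℝ) ^ (1 + δ / 2)) *
    ∑ i, ENNReal.ofReal (|c i| ^ (2 + δ)) *
      ∫⁻ x, ENNReal.ofReal (|x - ∫ y, y ∂(μ i)| ^ (2 + δ)) ∂(μ i)

/-- Studentizing is scale invariant, and the empirical variance is the mean square minus the squared
mean. This produces the self-normalized form with `r = 1 / n`. -/
lemma studentized_const_mul (hn : 0 < n) {s : ℝ} (hs : 0 < s) (a : Fin n → ℝ) :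
    studentized (fun i => s * a i) =
      (∑ i, a i) / √(∑ i, a i ^ 2 - 1 / (n : ℝ) * (∑ i, a i) ^ 2) := by
  have hn' : (0 : ℝ) < n := Nat.cast_pos.2 hn
  have e : empVar (fun i => s * a i) =
      (s / √n) ^ 2 * (∑ i, a i ^ 2 - 1 / (n : ℝ) * (∑ i, a i) ^ 2) := by
    unfold empVar
    rw [← Finset.mul_sum, div_pow, Real.sq_sqrt hn'.le]
    have : ∀ i, (s * a i - 1 / (n : ℝ) * (s * ∑ j, a j)) ^ 2 =
        s ^ 2 * a i ^ 2 - 2 * s ^ 2 / n * (∑ j, a j) * a i + s ^ 2 / n ^ 2 * (∑ j, a j) ^ 2 := by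
      intro i; field_simp; ring
    simp_rw [this]
    rw [Finset.sum_add_distrib, Finset.sum_sub_distrib, ← Finset.mul_sum, ← Finset.mul_sum,
      Finset.sum_const, Finset.card_univ, Fintype.card_fin, nsmul_eq_mul]
    field_simp
    ring
  have hs' : 0 < s / √(n : ℝ) := by positivity
  unfold studentized
  rw [e, Real.sqrt_mul (sq_nonneg _), Real.sqrt_sq hs'.le, ← Finset.mul_sum,
    show 1 / √(n : ℝ) * (s * ∑ i, a i) = s / √n * ∑ i, a i by ring,
    mul_div_mul_left _ _ hs'.ne']

variable {μ : Fin n → Measure ℝ} [∀ i, IsProbabilityMeasure (μ i)] {c : Fin n → ℝ}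

omit [∀ i, IsProbabilityMeasure (μ i)] in
lemma measurable_weightedResid (i : Fin n) : Measurable fun x => weightedResid μ c x i := by
  unfold weightedResid
  fun_prop

lemma memLp_weightedResid (h2 : ∀ i, MemLp id 2 (μ i)) (i : Fin n) :
    MemLp (fun x => weightedResid μ c x i) 2 (Measure.pi μ) := by
  have : MemLp (fun x => (x - ∫ y, y ∂(μ i)) * c i) 2 (μ i) :=
    ((h2 i).sub (memLp_const _)).mul_const _
  exact this.comp_measurePreserving (measurePreserving_eval μ i)

lemma iIndepFun_weightedResid (s : ℝ) :
    iIndepFun (fun i x => s * weightedResid μ c x i) (Measure.pi μ) :=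
  iIndepFun_pi (X := fun i x => s * ((x - ∫ y, y ∂(μ i)) * c i)) fun i => by fun_prop

lemma integral_weightedResid (h2 : ∀ i, MemLp id 2 (μ i)) (i : Fin n) :
    ∫ x, weightedResid μ c x i ∂(Measure.pi μ) = 0 := by
  have hi : Integrable (fun x : ℝ => x) (μ i) := (h2 i).integrable one_le_two
  unfold weightedResid
  rw [integral_comp_eval (μ := μ) (i := i) (f := fun x => (x - ∫ y, y ∂(μ i)) * c i) (by fun_prop),
    integral_mul_const, integral_sub hi (integrable_const _)]
  simp

lemma integral_sq_weightedResid (i : Fin n) :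
    ∫ x, weightedResid μ c x i ^ 2 ∂(Measure.pi μ) = variance id (μ i) * c i ^ 2 := by
  unfold weightedResid
  rw [integral_comp_eval (μ := μ) (i := i) (f := fun x => ((x - ∫ y, y ∂(μ i)) * c i) ^ 2) (by fun_prop)]
  simp_rw [mul_pow]
  rw [integral_mul_const, variance_eq_integral aemeasurable_id]
  rfl

/-- Lyapunov implies Lindeberg: on the tail, `1 ≤ (|x| / η) ^ δ`. -/
lemma indicator_sq_le_rpow {δ η x : ℝ} (hδ : 0 < δ) (hη : 0 < η) :
    {x : ℝ | η < |x|}.indicator (fun x => x ^ 2) x ≤ η ^ (-δ) * |x| ^ (2 + δ) := by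
  by_cases h : η < |x|
  · simp only [Set.indicator, Set.mem_ofPred_eq, h, if_true]
    have hx : 0 < |x| := hη.trans h
    rw [Real.rpow_add hx, Real.rpow_neg hη.le, Real.rpow_two, sq_abs]
    have h3 : η ^ δ ≤ |x| ^ δ := Real.rpow_le_rpow hη.le h.le hδ.le
    have h4 : 0 < η ^ δ := Real.rpow_pos_of_pos hη _
    rw [← div_eq_inv_mul, le_div_iff₀ h4]
    exact mul_le_mul_of_nonneg_left h3 (sq_nonneg _)
  · simp only [Set.indicator, Set.mem_ofPred_eq, h, if_false]
    positivity

lemma ofReal_sum_tailMoment_le (h2 : ∀ i, MemLp id 2 (μ i)) {ε δ η : ℝ} (hε : 0 < ε)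
    (hδ : 0 < δ) (hη : 0 < η) (hn : 0 < n) (hV : ε ≤ weightedVar μ c) :
    ENNReal.ofReal (∑ i, tailMoment (Measure.pi μ)
        (fun x => (√(n * weightedVar μ c))⁻¹ * weightedResid μ c x i) η) ≤
      ENNReal.ofReal (η ^ (-δ) * (ε ^ (1 + δ / 2))⁻¹) * weightedLyapunov δ μ c := by
  have hn' : (0 : ℝ) < n := Nat.cast_pos.2 hn
  set s := √(n * weightedVar μ c) with hs
  have hs0 : 0 < s := Real.sqrt_pos.2 (mul_pos hn' (hε.trans_le hV))
  -- Since `s ^ 2 ≥ n ε`, normalizing yields exactly the power of `n` in the Lyapunov sum.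
  have hsn : (s⁻¹) ^ (2 + δ) ≤ (ε ^ (1 + δ / 2))⁻¹ * (1 / (n : ℝ) ^ (1 + δ / 2)) := by
    have e : s ^ (2 + δ) = (n * weightedVar μ c) ^ (1 + δ / 2) := by
      rw [hs, Real.sqrt_eq_rpow, ← Real.rpow_mul (mul_pos hn' (hε.trans_le hV)).le]
      congr 1; ring
    rw [Real.inv_rpow hs0.le, e, one_div, ← mul_inv, ← Real.mul_rpow hε.le hn'.le,
      mul_comm ε]
    gcongr
  rw [ENNReal.ofReal_sum_of_nonneg fun i _ => tailMoment_nonneg _ _, weightedLyapunov,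
    ← mul_assoc, Finset.mul_sum]
  refine Finset.sum_le_sum fun i _ => ?_
  have hmeas : Measurable fun x => s⁻¹ * weightedResid μ c x i :=
    (measurable_weightedResid i).const_mul _
  have hm2 : MemLp (fun x => s⁻¹ * weightedResid μ c x i) 2 (Measure.pi μ) :=
    (memLp_weightedResid h2 i).const_mul _
  rw [tailMoment, ofReal_integral_eq_lintegral_ofReal (integrable_tailMoment hmeas hm2 η)
    (ae_of_all _ fun x => Set.indicator_nonneg (fun _ _ => sq_nonneg _) x)]
  have hpt : ∀ x : Fin n → ℝ, ENNReal.ofReal ({x | η < |s⁻¹ * weightedResid μ c x i|}.indicator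
      (fun x => (s⁻¹ * weightedResid μ c x i) ^ 2) x) ≤
      ENNReal.ofReal (η ^ (-δ) * (ε ^ (1 + δ / 2))⁻¹) *
        ENNReal.ofReal (1 / (n : ℝ) ^ (1 + δ / 2)) * ENNReal.ofReal (|c i| ^ (2 + δ)) *
        ENNReal.ofReal (|x i - ∫ y, y ∂(μ i)| ^ (2 + δ)) := by
    intro x
    rw [← ENNReal.ofReal_mul (by positivity), ← ENNReal.ofReal_mul (by positivity),
      ← ENNReal.ofReal_mul (by positivity)]
    refine ENNReal.ofReal_le_ofReal
      ((indicator_sq_le_rpow (x := s⁻¹ * weightedResid μ c x i) hδ hη).trans ?_)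
    rw [weightedResid, abs_mul, abs_mul, Real.mul_rpow (abs_nonneg _) (by positivity),
      Real.mul_rpow (abs_nonneg _) (abs_nonneg _), abs_of_pos (inv_pos.2 hs0)]
    calc η ^ (-δ) * (s⁻¹ ^ (2 + δ) *
          (|x i - ∫ y, y ∂(μ i)| ^ (2 + δ) * |c i| ^ (2 + δ)))
        ≤ η ^ (-δ) * (((ε ^ (1 + δ / 2))⁻¹ * (1 / (n : ℝ) ^ (1 + δ / 2))) *
          (|x i - ∫ y, y ∂(μ i)| ^ (2 + δ) * |c i| ^ (2 + δ))) := by gcongr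
      _ = _ := by ring
  refine (lintegral_mono hpt).trans ?_
  rw [lintegral_const_mul _ (by fun_prop)]
  have he : ∫⁻ x : Fin n → ℝ, ENNReal.ofReal (|x i - ∫ y, y ∂(μ i)| ^ (2 + δ)) ∂(Measure.pi μ) =
      ∫⁻ x, ENNReal.ofReal (|x - ∫ y, y ∂(μ i)| ^ (2 + δ)) ∂(μ i) :=
    (measurePreserving_eval μ i).lintegral_comp
      (f := fun x => ENNReal.ofReal (|x - ∫ y, y ∂(μ i)| ^ (2 + δ))) (by fun_prop)
  rw [he, mul_assoc (ENNReal.ofReal _ * ENNReal.ofReal _)]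

end Coordinates

lemma tendsto_measureReal_studentized_le {n : ℕ → ℕ} (hn0 : ∀ k, 0 < n k)
    (hn : Tendsto n atTop atTop) {μ : ∀ k, Fin (n k) → Measure ℝ}
    [∀ k i, IsProbabilityMeasure (μ k i)] {c : ∀ k, Fin (n k) → ℝ}
    (h2 : ∀ k i, MemLp id 2 (μ k i)) {ε δ : ℝ} (hε : 0 < ε) (hδ : 0 < δ)
    (hV : ∀ k, ε ≤ weightedVar (μ k) (c k))
    (hL : Tendsto (fun k => weightedLyapunov δ (μ k) (c k)) atTop (𝓝 0)) (t : ℝ) :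
    Tendsto (fun k => (Measure.pi (μ k)).real
      {x | studentized (weightedResid (μ k) (c k) x) ≤ t}) atTop
      (𝓝 (cdf (gaussianReal 0 1) t)) := by
  have hn' : ∀ k, (0 : ℝ) < n k := fun k => Nat.cast_pos.2 (hn0 k)
  set s : ℕ → ℝ := fun k => √(n k * weightedVar (μ k) (c k)) with hs
  have hnV : ∀ k, 0 < n k * weightedVar (μ k) (c k) := fun k =>
    mul_pos (hn' k) (hε.trans_le (hV k))
  have hs0 : ∀ k, 0 < s k := fun k => Real.sqrt_pos.2 (hnV k)
  have h := tendsto_measureReal_selfNormalized_le_of_lindeberg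
    (P := fun k => Measure.pi (μ k))
    (a := fun k i x => (s k)⁻¹ * weightedResid (μ k) (c k) x i)
    (fun k i => (measurable_weightedResid i).const_mul _)
    (fun k => iIndepFun_weightedResid _)
    (fun k i => (memLp_weightedResid (h2 k) i).const_mul _)
    (fun k i => by rw [integral_const_mul, integral_weightedResid (h2 k), mul_zero])
    (fun k => by
      simp_rw [mul_pow, integral_const_mul, integral_sq_weightedResid]
      rw [← Finset.mul_sum, inv_pow, hs, Real.sq_sqrt (hnV k).le, inv_mul_eq_one₀ (hnV k).ne',
        weightedVar]
      have := (hn' k).ne'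
      field_simp)
    (fun η hη => by
      have hlim : Tendsto (fun k => ENNReal.ofReal (∑ i, tailMoment (Measure.pi (μ k))
          (fun x => (s k)⁻¹ * weightedResid (μ k) (c k) x i) η)) atTop (𝓝 0) := by
        refine tendsto_of_tendsto_of_tendsto_of_le_of_le tendsto_const_nhds ?_
          (fun k => zero_le) fun k => ofReal_sum_tailMoment_le (h2 k) hε hδ hη (hn0 k) (hV k)
        simpa using ENNReal.Tendsto.const_mul hL (Or.inr ENNReal.ofReal_ne_top)
      refine ((ENNReal.tendsto_toReal ENNReal.zero_ne_top).comp hlim).congr fun k => ?_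
      exact ENNReal.toReal_ofReal (Finset.sum_nonneg fun i _ => tailMoment_nonneg _ _))
    (r := fun k => 1 / (n k : ℝ)) (fun k => by positivity)
    (tendsto_const_nhds.div_atTop (tendsto_natCast_atTop_atTop.comp hn)) t
  refine h.congr fun k => ?_
  congr 2 with x
  rw [← studentized_const_mul (hn0 k) (hs0 k)]
  congr! 4 with i
  rw [mul_inv_cancel_left₀ (hs0 k).ne']

/-- The normal approximation of the studentized sum is uniform over all arrays with a given lower
bound on the average variance and a small Lyapunov sum. -/
theorem exists_forall_abs_studentized_sub_cdf_lt {ε δ γ : ℝ} (hε : 0 < ε) (hδ : 0 < δ)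
    (hγ : 0 < γ) (t : ℝ) :
    ∃ η : ℝ≥0∞, 0 < η ∧ ∃ N : ℕ, ∀ n ≥ N, ∀ (μ : Fin n → Measure ℝ) (c : Fin n → ℝ),
      (∀ i, IsProbabilityMeasure (μ i)) → (∀ i, MemLp id 2 (μ i)) →
      ε ≤ weightedVar μ c → weightedLyapunov δ μ c < η →
      |(Measure.pi μ).real {x | studentized (weightedResid μ c x) ≤ t} -
        cdf (gaussianReal 0 1) t| < γ := by
  by_contra! hcon
  have hpos : ∀ k : ℕ, (0 : ℝ≥0∞) < ((k : ℝ≥0∞) + 1)⁻¹ := fun k => by simp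
  -- The bound `k + 1` on the row length makes every row nonempty and the lengths tend to infinity.
  choose n hn μ c hμ h2 hV hL hγ' using fun k : ℕ => hcon _ (hpos k) (k + 1)
  have hlim : Tendsto (fun k => weightedLyapunov δ (μ k) (c k)) atTop (𝓝 0) := by
    refine tendsto_of_tendsto_of_tendsto_of_le_of_le tendsto_const_nhds ?_
      (fun k => zero_le) fun k => (hL k).le
    have := (tendsto_add_atTop_iff_nat 1).2 ENNReal.tendsto_inv_nat_nhds_zero
    simpa using this
  have := tendsto_measureReal_studentized_le (fun k => (Nat.succ_pos k).trans_le (hn k))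
    (tendsto_atTop_mono hn (tendsto_add_atTop_nat 1)) h2 hε hδ hV hlim t
  obtain ⟨k, hk⟩ := (Metric.tendsto_nhds.1 this γ hγ).exists
  exact absurd hk (not_lt.2 (hγ' k))

/-! ### Conditional probabilities under a composition-product -/

/-- The right side depends on the first coordinate only, and its integral over a cylinder `u × β` is
the mass of `s` there, by the formula for `ν ⊗ₘ κ`. -/
lemma condExp_indicator_compProd {α β : Type*} [MeasurableSpace α] [MeasurableSpace β]
    (ν : Measure α) [IsProbabilityMeasure ν] (κ : Kernel α β) [IsMarkovKernel κ]
    {s : Set (α × β)} (hs : MeasurableSet s) :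
    (ν ⊗ₘ κ)⟦s | MeasurableSpace.comap Prod.fst inferInstance⟧ =ᵐ[ν ⊗ₘ κ]
      fun ω => (κ ω.1).real (Prod.mk ω.1 ⁻¹' s) := by
  have hg : Measurable fun a => (κ a).real (Prod.mk a ⁻¹' s) :=
    (Kernel.measurable_kernel_prodMk_left hs).ennreal_toReal
  have hint : Integrable (fun ω : α × β => (κ ω.1).real (Prod.mk ω.1 ⁻¹' s)) (ν ⊗ₘ κ) := by
    refine Integrable.of_bound (C := 1) (hg.comp measurable_fst).aestronglyMeasurable
      (ae_of_all _ fun ω => ?_)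
    rw [Real.norm_eq_abs, abs_of_nonneg measureReal_nonneg]
    exact measureReal_le_one
  symm
  refine ae_eq_condExp_of_forall_setIntegral_eq measurable_fst.comap_le ?_
    (fun t _ _ => hint.integrableOn) ?_ ?_
  · exact (integrable_const _).indicator hs
  · rintro t ⟨u, hu, rfl⟩ -
    have h1 : ∫ ω in Prod.fst ⁻¹' u, (κ ω.1).real (Prod.mk ω.1 ⁻¹' s) ∂(ν ⊗ₘ κ) =
        ∫ a in u, (κ a).real (Prod.mk a ⁻¹' s) ∂ν := by
      conv_rhs => rw [← Measure.fst_compProd ν κ, Measure.fst]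
      rw [setIntegral_map hu hg.aestronglyMeasurable measurable_fst.aemeasurable]
    rw [h1, integral_indicator_const _ hs, measureReal_restrict_apply hs, smul_eq_mul, mul_one]
    simp_rw [measureReal_def]
    rw [integral_toReal (Kernel.measurable_kernel_prodMk_left hs).aemeasurable
      (ae_of_all _ fun a => measure_lt_top _ _),
      Measure.compProd_apply (hs.inter (measurable_fst hu)), ← lintegral_indicator hu]
    congr 2 with a
    rw [Set.preimage_inter]
    by_cases ha : a ∈ u
    · have e : Prod.mk a ⁻¹' (Prod.fst ⁻¹' u) = (Set.univ : Set β) := by ext; simpa using ha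
      rw [e, Set.inter_univ, Set.indicator_of_mem ha]
    · have e : Prod.mk a ⁻¹' (Prod.fst ⁻¹' u) = (∅ : Set β) := by ext; simpa using ha
      rw [e, Set.inter_empty, measure_empty, Set.indicator_of_notMem ha]
  · exact (hg.comp (Measurable.of_comap_le le_rfl)).aestronglyMeasurable

/-! ### Measurability -/

section Measurability

variable {n p : ℕ} {Q : LawLearner n p} {m : MeanLearner n p}

/-- The learned law of `X_i` given `Z_i`, as a kernel from the data. -/
def fittedKernel (Q : LawLearner n p) (i : Fin n) : Kernel (Data n p) ℝ where
  toFun d := fittedLaw Q d i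
  measurable' := measurable_fittedLaw Q i

instance [IsMarkovKernel Q] (i : Fin n) : IsMarkovKernel (fittedKernel Q i) :=
  ⟨fun d => inferInstanceAs (IsProbabilityMeasure (fittedLaw Q d i))⟩

instance [IsMarkovKernel Q] : IsMarkovKernel (resampleKernel Q) :=
  ⟨fun d => inferInstanceAs (IsProbabilityMeasure (Measure.pi fun i => fittedLaw Q d i))⟩

instance (L : Measure (Obs p)) [IsProbabilityMeasure L] : IsProbabilityMeasure (dataLaw n L) := by
  unfold dataLaw; infer_instance

lemma measurable_muHatX [IsMarkovKernel Q] (i : Fin n) : Measurable fun d => muHatX Q d i :=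
  (StronglyMeasurable.integral_kernel (κ := fittedKernel Q i)
    (f := fun x : ℝ => x) stronglyMeasurable_id).measurable

lemma measurable_residY (hm : Measurable m) (i : Fin n) :
    Measurable fun d : Data n p => yObs d i - muHatY m d i := by
  unfold muHatY yObs zObs
  refine Measurable.sub (by fun_prop) (hm.comp (by fun_prop))

lemma measurable_variance_fittedLaw [IsMarkovKernel Q] (i : Fin n) :
    Measurable fun d => variance id (fittedLaw Q d i) := by
  have h : StronglyMeasurable fun q : Data n p × ℝ => (q.2 - muHatX Q q.1 i) ^ 2 := by
    have : Measurable fun q : Data n p × ℝ => muHatX Q q.1 i :=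
      (measurable_muHatX i).comp measurable_fst
    exact ((measurable_snd.sub this).pow_const 2).stronglyMeasurable
  have h2 := (h.integral_kernel_prod_right' (κ := fittedKernel Q i)).measurable
  convert h2 using 2 with d
  rw [variance_eq_integral aemeasurable_id]
  rfl

lemma measurable_resampVar [IsMarkovKernel Q] (hm : Measurable m) :
    Measurable (resampVar Q m) := by
  unfold resampVar
  exact (Finset.measurable_fun_sum _ fun i _ => (measurable_variance_fittedLaw i).mul
    ((measurable_residY hm i).pow_const 2)).const_mul _

lemma measurable_empVar : Measurable (empVar (n := n)) := by
  unfold empVar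
  fun_prop

lemma measurable_statNDCRT [IsMarkovKernel Q] (hm : Measurable m) :
    Measurable fun ω : Data n p × (Fin n → ℝ) => statNDCRT Q m ω.2 ω.1 := by
  have hr : ∀ i, Measurable fun ω : Data n p × (Fin n → ℝ) => residProd Q m ω.2 ω.1 i := by
    intro i
    have h1 : Measurable fun ω : Data n p × (Fin n → ℝ) => ω.2 i := by fun_prop
    exact (h1.sub ((measurable_muHatX i).comp measurable_fst)).mul
      ((measurable_residY hm i).comp measurable_fst)
  unfold statNDCRT statDCRT sdGCM
  exact ((Finset.measurable_fun_sum _ fun i _ => hr i).const_mul _).div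
    (measurable_empVar.comp (measurable_pi_lambda _ hr)).sqrt

end Measurability

/-! ### Quantiles -/

section Quantile

variable {ν : Measure ℝ} [IsProbabilityMeasure ν] {q t : ℝ}

lemma bddBelow_quantile_set (hq : 0 < q) : BddBelow {t : ℝ | q ≤ ν.real (Set.Iic t)} := by
  obtain ⟨b, hb⟩ := ((tendsto_cdf_atBot ν).eventually_lt_const hq).exists
  refine ⟨b, fun t ht => le_of_not_gt fun h => ?_⟩
  have := monotone_cdf ν h.le
  rw [cdf_eq_real ν t] at this
  exact absurd hb (not_lt.2 (le_trans ht this))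

lemma quantile_set_nonempty (hq : q < 1) : {t : ℝ | q ≤ ν.real (Set.Iic t)}.Nonempty := by
  obtain ⟨b, hb⟩ := ((tendsto_cdf_atTop ν).eventually_const_lt hq).exists
  exact ⟨b, by rw [cdf_eq_real] at hb; exact hb.le⟩

lemma quantile_le (hq : 0 < q) (h : q ≤ ν.real (Set.Iic t)) : quantile ν q ≤ t :=
  csInf_le (bddBelow_quantile_set hq) h

lemma le_quantile (hq : q < 1) (h : ν.real (Set.Iic t) < q) : t ≤ quantile ν q :=
  le_csInf (quantile_set_nonempty hq) fun s hs => le_of_not_gt fun hst =>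
    absurd (le_trans hs (measureReal_mono (Set.Iic_subset_Iic.2 hst.le))) (not_le.2 h)

lemma measureReal_Iic_lt_of_lt_quantile (hq : 0 < q) (h : t < quantile ν q) :
    ν.real (Set.Iic t) < q :=
  lt_of_not_ge fun h' => absurd (quantile_le hq h') (not_le.2 h)

/-- Strict increase excludes a flat stretch at level `q`, on which only equality would hold. -/
lemma lt_cdf_of_quantile_lt (hν : StrictMono (cdf ν)) (hq : q < 1) (h : quantile ν q < t) :
    q < cdf ν t := by
  obtain ⟨s, hs, hst⟩ := exists_lt_of_csInf_lt (quantile_set_nonempty hq) h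
  have := hν hst
  rw [cdf_eq_real ν s] at this
  exact lt_of_le_of_lt hs this

end Quantile

/-! ### Convergence of the resampling distribution, its quantiles and the tests -/

section Asymptotics

variable {p : ℕ → ℕ} {L : ∀ n, Measure (Obs (p n))} [∀ n, IsProbabilityMeasure (L n)]
  {Q : ∀ n, LawLearner n (p n)} [∀ n, IsMarkovKernel (Q n)] {m : ∀ n, MeanLearner n (p n)}

lemma tendsto_measure_resampVar_lt (hm : ∀ n, Measurable (m n)) {ε : ℝ}
    (h : Tendsto (fun n => dataLaw n (L n) {d | ε ≤ resampVar (Q n) (m n) d}) atTop (𝓝 1)) :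
    Tendsto (fun n => dataLaw n (L n) {d | resampVar (Q n) (m n) d < ε}) atTop (𝓝 0) := by
  have h2 := ENNReal.Tendsto.sub (tendsto_const_nhds (x := (1 : ℝ≥0∞))) h
    (Or.inl ENNReal.one_ne_top)
  rw [tsub_self] at h2
  refine h2.congr fun n => ?_
  rw [← prob_compl_eq_one_sub (measurableSet_le measurable_const (measurable_resampVar (hm n)))]
  congr 1 with d
  simp

theorem tendstoInProb_resample_cdf (hm : ∀ n, Measurable (m n)) (hndg1 : Nondegenerate1 p L Q m)
    (hndg2 : Nondegenerate2 p L Q m) (hlyap : LyapunovCondition p L Q m) (t : ℝ) :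
    TendstoInProb (fun n => dataLaw n (L n))
      (fun n d => (resampleKernel (Q n) d).real {x | statNDCRT (Q n) (m n) x d ≤ t})
      (cdf (gaussianReal 0 1) t) := by
  intro γ hγ
  obtain ⟨ε, hε, hV⟩ := hndg1
  obtain ⟨δ, hδ, hL⟩ := hlyap
  obtain ⟨η, hη, N, hN⟩ := exists_forall_abs_studentized_sub_cdf_lt hε hδ hγ t
  have hlim := (tendsto_measure_resampVar_lt hm hV).add (hL η hη)
  rw [add_zero] at hlim
  refine tendsto_of_tendsto_of_tendsto_of_le_of_le' tendsto_const_nhds hlim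
    (Eventually.of_forall fun n => zero_le) ?_
  filter_upwards [eventually_ge_atTop N] with n hn
  refine (measure_mono_ae ?_).trans (measure_union_le _ _)
  filter_upwards [hndg2 n] with d hd hdγ
  by_contra hcon
  have hV' : ε ≤ resampVar (Q n) (m n) d := not_lt.1 fun h => hcon (Or.inl h)
  have hL' : lyapunovSum (Q n) (m n) δ d < η := not_le.1 fun h => hcon (Or.inr h)
  -- For these laws and weights, `studentized`, `weightedVar` and `weightedLyapunov` unfold to the
  -- statistic, `resampVar` and `lyapunovSum`. The second moments come from the finite learned
  -- variances.
  refine absurd hdγ (not_le.2 (hN n hn (fittedLaw (Q n) d)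
    (fun i => yObs d i - muHatY (m n) d i) (fun i => inferInstance) (fun i => ?_) hV' hL'))
  exact (evariance_lt_top_iff_memLp aestronglyMeasurable_id).1 (hd i).1.2

theorem condTendstoInDistribution_statNDCRT (hm : ∀ n, Measurable (m n))
    (hndg1 : Nondegenerate1 p L Q m) (hndg2 : Nondegenerate2 p L Q m)
    (hlyap : LyapunovCondition p L Q m) :
    CondTendstoInDistribution (fun n => dataSigma n (p n)) (fun n => jointLaw (L n) (Q n))
      (fun n ω => statNDCRT (Q n) (m n) ω.2 ω.1) (gaussianReal 0 1) := by
  intro t _ γ hγ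
  refine (tendstoInProb_resample_cdf hm hndg1 hndg2 hlyap t γ hγ).congr fun n => ?_
  have hs : MeasurableSet {ω : Data n (p n) × (Fin n → ℝ) | statNDCRT (Q n) (m n) ω.2 ω.1 ≤ t} :=
    measurableSet_le (measurable_statNDCRT (hm n)) measurable_const
  have hce := condExp_indicator_compProd (dataLaw n (L n)) (resampleKernel (Q n)) hs
  have hg : Measurable fun d =>
      (resampleKernel (Q n) d).real {x | statNDCRT (Q n) (m n) x d ≤ t} :=
    (Kernel.measurable_kernel_prodMk_left hs).ennreal_toReal
  have hset : MeasurableSet {d | γ ≤ |(resampleKernel (Q n) d).real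
      {x | statNDCRT (Q n) (m n) x d ≤ t} - cdf (gaussianReal 0 1) t|} :=
    measurableSet_le measurable_const (hg.sub_const _).abs
  beta_reduce
  -- The event concerns the data alone, so its probability can be computed on the joint space, where
  -- the conditional expectation lives.
  conv_lhs => rw [← Measure.fst_compProd (dataLaw n (L n)) (resampleKernel (Q n)),
    Measure.fst_apply hset]
  refine measure_congr ?_
  filter_upwards [hce] with ω hω
  have hω' : ((jointLaw (L n) (Q n))⟦{ω | statNDCRT (Q n) (m n) ω.2 ω.1 ≤ t} |
      dataSigma n (p n)⟧) ω =
      (resampleKernel (Q n) ω.1).real {x | statNDCRT (Q n) (m n) x ω.1 ≤ t} := hω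
  change (γ ≤ |_ - _|) = (γ ≤ |_ - _|)
  rw [hω']

theorem tendstoInProb_critNDCRT (hm : ∀ n, Measurable (m n)) {α : ℝ}
    (hα : α ∈ Set.Ioo (0 : ℝ) 1) (hndg1 : Nondegenerate1 p L Q m)
    (hndg2 : Nondegenerate2 p L Q m) (hlyap : LyapunovCondition p L Q m) :
    TendstoInProb (fun n => dataLaw n (L n)) (fun n => critNDCRT (Q n) (m n) α)
      (zQuantile α) := by
  intro ε hε
  have hq0 : 0 < 1 - α := by linarith [hα.2]
  have hq1 : 1 - α < 1 := by linarith [hα.1]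
  set z := zQuantile α with hz
  -- Both gaps to `1 - α` are strict and serve as the tolerances for the conditional cdf. Half of
  -- `ε` is used because the event to exclude contains `|C - z| = ε`.
  have hlo : cdf (gaussianReal 0 1) (z - ε / 2) < 1 - α := by
    rw [cdf_eq_real]
    exact measureReal_Iic_lt_of_lt_quantile hq0 (by change z - ε / 2 < z; linarith)
  have hhi : 1 - α < cdf (gaussianReal 0 1) (z + ε / 2) :=
    lt_cdf_of_quantile_lt strictMono_cdf_gaussianReal hq1 (by change z < z + ε / 2; linarith)
  have hlim := (tendstoInProb_resample_cdf hm hndg1 hndg2 hlyap (z - ε / 2) _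
    (sub_pos.2 hlo)).add (tendstoInProb_resample_cdf hm hndg1 hndg2 hlyap (z + ε / 2) _
    (sub_pos.2 hhi))
  rw [add_zero] at hlim
  refine tendsto_of_tendsto_of_tendsto_of_le_of_le tendsto_const_nhds hlim
    (fun n => zero_le) fun n => (measure_mono fun d hd => ?_).trans (measure_union_le _ _)
  by_contra hcon
  simp only [Set.mem_union, Set.mem_ofPred_eq, not_or, not_le] at hcon
  have hmx : Measurable fun x => statNDCRT (Q n) (m n) x d :=
    (measurable_statNDCRT (hm n)).comp measurable_prodMk_left
  have hF : ∀ t, ((resampleKernel (Q n) d).map fun x => statNDCRT (Q n) (m n) x d).real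
      (Set.Iic t) = (resampleKernel (Q n) d).real {x | statNDCRT (Q n) (m n) x d ≤ t} :=
    fun t => map_measureReal_apply hmx measurableSet_Iic
  have := Measure.isProbabilityMeasure_map (μ := resampleKernel (Q n) d) hmx.aemeasurable
  have h1 : z - ε / 2 ≤ critNDCRT (Q n) (m n) α d := by
    refine le_quantile hq1 ?_
    rw [hF]
    linarith [(abs_lt.1 hcon.1).2]
  have h2 : critNDCRT (Q n) (m n) α d ≤ z + ε / 2 := by
    refine quantile_le hq0 ?_
    rw [hF]
    linarith [(abs_lt.1 hcon.2).1]
  have h3 : ε ≤ |critNDCRT (Q n) (m n) α d - z| := hd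
  have h4 : |critNDCRT (Q n) (m n) α d - z| ≤ ε / 2 := abs_le.2 ⟨by linarith, by linarith⟩
  linarith

theorem tendsto_measure_tests_eq {α : ℝ}
    (hcrit : TendstoInProb (fun n => dataLaw n (L n)) (fun n => critNDCRT (Q n) (m n) α)
      (zQuantile α)) (hacc : NonAccumulation p L Q m α) :
    Tendsto (fun n => dataLaw n (L n)
      {d | testNDCRT (Q n) (m n) α d = testGCM (Q n) (m n) α d}) atTop (𝓝 1) := by
  have hsub : ∀ δ > 0, ∀ n, dataLaw n (L n)
      {d | testNDCRT (Q n) (m n) α d = testGCM (Q n) (m n) α d}ᶜ ≤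
      dataLaw n (L n) {d | |statGCM (Q n) (m n) d - zQuantile α| ≤ δ} +
      dataLaw n (L n) {d | δ ≤ |critNDCRT (Q n) (m n) α d - zQuantile α|} := by
    intro δ hδ n
    refine (measure_mono fun d hd => ?_).trans (measure_union_le _ _)
    by_contra hcon
    simp only [Set.mem_union, Set.mem_ofPred_eq, not_or, not_le] at hcon
    refine hd ?_
    obtain ⟨h1, h2⟩ := hcon
    obtain ⟨h3, h4⟩ := abs_lt.1 h2
    have h5 : statNDCRT (Q n) (m n) (xObs d) d = statGCM (Q n) (m n) d := rfl
    have h6 : (critNDCRT (Q n) (m n) α d < statNDCRT (Q n) (m n) (xObs d) d) ↔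
        (zQuantile α < statGCM (Q n) (m n) d) := by
      rw [h5]
      -- The statistic is farther than `δ` from `z` and the critical value is closer, so both
      -- thresholds lie on the same side of the statistic.
      rcases lt_abs.1 h1 with h | h
      · constructor <;> intro <;> linarith
      · constructor <;> intro <;> linarith
    simp only [Set.mem_ofPred_eq, testNDCRT, testGCM, Set.indicator, h6]
  have hcompl : Tendsto (fun n => dataLaw n (L n)
      {d | testNDCRT (Q n) (m n) α d = testGCM (Q n) (m n) α d}ᶜ) atTop (𝓝 0) := by
    refine tendsto_order.2 ⟨fun b hb => absurd hb not_lt_zero, fun b hb => ?_⟩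
    obtain ⟨δ, h1, h2⟩ := ((hacc.eventually_lt_const (ENNReal.half_pos hb.ne')).and
      self_mem_nhdsWithin).exists
    filter_upwards [eventually_lt_of_limsup_lt h1,
      (hcrit δ h2).eventually_lt_const (ENNReal.half_pos hb.ne')] with n h3 h4
    calc _ ≤ _ := hsub δ h2 n
      _ < b / 2 + b / 2 := ENNReal.add_lt_add h3 h4
      _ = b := ENNReal.add_halves b
  have hlow := ENNReal.Tendsto.sub (tendsto_const_nhds (x := (1 : ℝ≥0∞))) hcompl
    (Or.inl ENNReal.one_ne_top)
  rw [tsub_zero] at hlow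
  -- Subadditivity alone bounds the event below by one minus its complement, so measurability of the
  -- resampling test is not needed.
  refine tendsto_of_tendsto_of_tendsto_of_le_of_le hlow tendsto_const_nhds (fun n => ?_)
    fun n => prob_le_one
  refine tsub_le_iff_right.2 ?_
  rw [← measure_univ (μ := dataLaw n (L n)), ← Set.union_compl_self
    {d | testNDCRT (Q n) (m n) α d = testGCM (Q n) (m n) α d}]
  exact measure_union_le _ _

end Asymptotics

end NDCRT

end

theorem mainTheorem9 (p : ℕ → ℕ) (L : ∀ n, Measure (NDCRT.Obs (p n)))
    [∀ n, IsProbabilityMeasure (L n)]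
    (Q : ∀ n, NDCRT.LawLearner n (p n)) [∀ n, IsMarkovKernel (Q n)]
    (m : ∀ n, NDCRT.MeanLearner n (p n)) (hm : ∀ n, Measurable (m n))
    (α : ℝ) (hα : α ∈ Set.Ioo (0 : ℝ) 1)
    (hndg1 : NDCRT.Nondegenerate1 p L Q m)
    (hndg2 : NDCRT.Nondegenerate2 p L Q m)
    (hlyap : NDCRT.LyapunovCondition p L Q m) :
    NDCRT.CondTendstoInDistribution (fun n => NDCRT.dataSigma n (p n))
        (fun n => NDCRT.jointLaw (L n) (Q n))
        (fun n ω => NDCRT.statNDCRT (Q n) (m n) ω.2 ω.1) (gaussianReal 0 1) ∧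
      NDCRT.TendstoInProb (fun n => NDCRT.dataLaw n (L n))
        (fun n => NDCRT.critNDCRT (Q n) (m n) α) (NDCRT.zQuantile α) ∧
      (NDCRT.NonAccumulation p L Q m α →
        Tendsto (fun n => NDCRT.dataLaw n (L n)
          {d | NDCRT.testNDCRT (Q n) (m n) α d = NDCRT.testGCM (Q n) (m n) α d}) atTop (𝓝 1)) := by
  have hcrit := NDCRT.tendstoInProb_critNDCRT hm hα hndg1 hndg2 hlyap
  exact ⟨NDCRT.condTendstoInDistribution_statNDCRT hm hndg1 hndg2 hlyap, hcrit,
    NDCRT.tendsto_measure_tests_eq hcrit⟩
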